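/- Let $n\ge 3$. Let $B_n$ be the Artin braid group with generators $\sigma_1,\dots,\sigma_{n-1}$ and relations $\sigma_i\sigma_{i+1}\sigma_i=\sigma_{i+1}\sigma_i\sigma_{i+1}$ for $1\le i\le n-2$ and $\sigma_j\sigma_i=\sigma_i\sigma_j$ for $|i-j|\ge 2$. Let $P_n=\ker(B_n\to\Sigma_n)$ be the pure braid group, the kernel of the homomorphism to the symmetric group sending $\sigma_i$ to the transposition $(i\ i{+}1)$, and for $1\le r<s\le n$ let $$A_{r,s}=\sigma_{s-1}\cdots\sigma_{r+1}\,\sigma_r^2\,\sigma_{r+1}^{-1}\cdots\sigma_{s-1}^{-1}\in P_n .$$ Let $F_k$ be the free group of rank $k$, and let $F_2=\langle x,y\rangle$. Call two homomorphisms $f,g\colon G\to H$ of groups equivalent if there are $\varphi\in\operatorname{Aut}(G)$ and $\psi\in\operatorname{Aut}(H)$ with $g\circ\varphi=\psi\circ f$. 1. If $k\ge 3$, there is no epimorphism from $P_n$ to $F_k$. 2. There is exactly one equivalence class of epimorphisms from $P_n$ to $F_2$; that is, epimorphisms $P_n\to F_2$ exist, and any two of them are equivalent. 3. For each $I\subseteq\{1,\dots,n\}$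 with $|I|=3$ or $|I|=4$ there is a unique homomorphism $f_I\colon P_n\to F_2$ with the following values on the $A_{r,s}$, $r<s$, and it is surjective. If $I=\{i<j<k\}$, then $$f_I(A_{i,j})=x,\quad f_I(A_{i,k})=y,\quad f_I(A_{j,k})=y^{-1}x^{-1},$$ and $f_I(A_{r,s})=1$ for all other $r<s$. If $I=\{i<j<k<l\}$, then $$f_I(A_{i,j})=f_I(A_{k,l})=x,\quad f_I(A_{i,k})=y,\quad f_I(A_{j,k})=f_I(A_{i,l})=y^{-1}x^{-1},\quad f_I(A_{j,l})=xyx^{-1},$$ and $f_I(A_{r,s})=1$ for all other $r<s$. Every epimorphism $f\colon P_n\to F_2$ has the form $f=\psi\circ f_I$ for some $\psi\in\operatorname{Aut}(F_2)$ and some $I$ with $|I|=3$ or $|I|=4$. -/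

import Mathlib

namespace PureBraid

/-- The defining relators of the Artin braid group on `n` strands. The generators
`σ_1, …, σ_{n-1}` are indexed from zero, by `Fin (n - 1)`; the generator with index `i`
braids the strands `i` and `i + 1` among the strands `0, …, n - 1`. -/
def braidRels (n : ℕ) : Set (FreeGroup (Fin (n - 1))) :=
  {w | (∃ i j : Fin (n - 1), (i : ℕ) + 1 = j ∧
          w = (FreeGroup.of i * FreeGroup.of j * FreeGroup.of i) *
            (FreeGroup.of j * FreeGroup.of i * FreeGroup.of j)⁻¹) ∨
       (∃ i j : Fin (n - 1), (i : ℕ) + 2 ≤ j ∧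
          w = (FreeGroup.of j * FreeGroup.of i) * (FreeGroup.of i * FreeGroup.of j)⁻¹)}

/-- The Artin braid group `B_n`. -/
abbrev BraidGroup (n : ℕ) : Type := PresentedGroup (braidRels n)

/-- The Artin generators. -/
def sigma {n : ℕ} (i : Fin (n - 1)) : BraidGroup n := PresentedGroup.of i

/-- The adjacent transposition exchanging `i` and `i + 1`. -/
def adjSwap {n : ℕ} (i : Fin (n - 1)) : Equiv.Perm (Fin n) :=
  Equiv.swap ⟨i, by omega⟩ ⟨i + 1, by omega⟩

theorem adjSwap_rels {n : ℕ} (w : FreeGroup (Fin (n - 1))) (hw : w ∈ braidRels n) :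
    FreeGroup.lift (adjSwap (n := n)) w = 1 := by
  rcases hw with ⟨i, j, hij, rfl⟩ | ⟨i, j, hij, rfl⟩
  · simp only [map_mul, map_inv, FreeGroup.lift_apply_of]
    rw [mul_inv_eq_one]
    ext a
    simp only [adjSwap, Equiv.Perm.mul_apply, Equiv.swap_apply_def, Fin.ext_iff]
    grind
  · simp only [map_mul, map_inv, FreeGroup.lift_apply_of]
    rw [mul_inv_eq_one]
    ext a
    simp only [adjSwap, Equiv.Perm.mul_apply, Equiv.swap_apply_def, Fin.ext_iff]
    grind

/-- The natural map from the braid group to the symmetric group. -/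
def toPerm (n : ℕ) : BraidGroup n →* Equiv.Perm (Fin n) :=
  PresentedGroup.toGroup (f := adjSwap) adjSwap_rels

theorem toPerm_sigma {n : ℕ} (i : Fin (n - 1)) : toPerm n (sigma i) = adjSwap i :=
  PresentedGroup.toGroup.of adjSwap_rels

/-- The Artin pure braid group `P_n`, the kernel of `B_n → Σ_n`. -/
abbrev PureBraidGroup (n : ℕ) : Type := (toPerm n).ker

/-- The product `σ_{r+d} ⋯ σ_{r+2} σ_{r+1}` (zero-based indices), for `r + d < n - 1`. -/
def descProd {n : ℕ} (r : ℕ) : (d : ℕ) → r + d < n - 1 → BraidGroup n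
  | 0, _ => 1
  | d + 1, h => sigma ⟨r + (d + 1), h⟩ * descProd r d (by omega)

/-- The braid `σ_{s-1} ⋯ σ_{r+1} σ_r² σ_{r+1}⁻¹ ⋯ σ_{s-1}⁻¹`, for strands `r < s`. -/
def bandBraid {n : ℕ} (r s : Fin n) (h : r < s) : BraidGroup n :=
  descProd (r : ℕ) (s - r - 1 : ℕ) (by have := Fin.lt_def.mp h; omega) *
    sigma ⟨r, by have := Fin.lt_def.mp h; omega⟩ ^ 2 *
    (descProd (r : ℕ) (s - r - 1 : ℕ) (by have := Fin.lt_def.mp h; omega))⁻¹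

/-- The standard generator `A_{r,s}` of the pure braid group. -/
def A {n : ℕ} (r s : Fin n) (h : r < s) : PureBraidGroup n :=
  ⟨bandBraid r s h, by
    simp [bandBraid, MonoidHom.mem_ker, toPerm_sigma, adjSwap, pow_two, Equiv.swap_mul_self]⟩

/-- The free group `F_k` of rank `k`. -/
abbrev F (k : ℕ) : Type := FreeGroup (Fin k)

/-- The first free generator of `F_2`. -/
def x : F 2 := FreeGroup.of 0

/-- The second free generator of `F_2`. -/
def y : F 2 := FreeGroup.of 1

/-- The prescribed value of `f_I` on `A_{r,s}` for `I = {i < j < k}`. -/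
def value₃ {n : ℕ} (i j k r s : Fin n) : F 2 :=
  if r = i ∧ s = j then x
  else if r = i ∧ s = k then y
  else if r = j ∧ s = k then y⁻¹ * x⁻¹
  else 1

/-- The prescribed value of `f_I` on `A_{r,s}` for `I = {i < j < k < l}`. -/
def value₄ {n : ℕ} (i j k l r s : Fin n) : F 2 :=
  if r = i ∧ s = j then x
  else if r = i ∧ s = k then y
  else if r = j ∧ s = k then y⁻¹ * x⁻¹
  else if r = i ∧ s = l then y⁻¹ * x⁻¹
  else if r = j ∧ s = l then x * y * x⁻¹
  else if r = k ∧ s = l then x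
  else 1

/-- `f` is the homomorphism `f_I`: `I` has three or four elements, and `f` takes the prescribed
values on the generators `A_{r,s}`. -/
def IsStandard {n : ℕ} (I : Finset (Fin n)) (f : PureBraidGroup n →* F 2) : Prop :=
  (∃ i j k : Fin n, i < j ∧ j < k ∧ I = {i, j, k} ∧
    ∀ (r s : Fin n) (h : r < s), f (A r s h) = value₃ i j k r s) ∨
  (∃ i j k l : Fin n, i < j ∧ j < k ∧ k < l ∧ I = {i, j, k, l} ∧
    ∀ (r s : Fin n) (h : r < s), f (A r s h) = value₄ i j k l r s)

/-- Homomorphisms `f, g : G → H` are equivalent if `g ∘ φ = ψ ∘ f` for some automorphisms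
`φ` of `G` and `ψ` of `H`. -/
def Equivalent {G H : Type*} [Group G] [Group H] (f g : G →* H) : Prop :=
  ∃ (φ : G ≃* G) (ψ : H ≃* H), ∀ a : G, g (φ a) = ψ (f a)

end PureBraid

/-! Let `a_{r,s}` be the image of `A_{r,s}` under a homomorphism from P_n to a free group.
Commutation is transitive on nontrivial elements of a free group (`commute_trans_of_isFreeGroup`),
and `A_{i,j} A_{i,k} A_{j,k}` commutes with each of its factors. So for every triple of strands the
three images either commute pairwise, or have product 1 and no two of them commute
(`triple_of_not_commute`). A nonabelian image forces a triple of the second kind, and conjugation by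
a braid moves it to the strands 0, 1, 2. Every further strand is then either invisible or has forced
values, and at most one is visible. Hence the homomorphism factors through some f_I with |I| = 3 or
4 (`exists_eq_comp_standardHom`). Rank at least 3 is excluded by comparing ranks; in rank 2 the
second factor is an automorphism because free groups of finite rank are Hopfian.

The f_I come from an action of B_3 on F_2 in which the squares of the generators act by inner
automorphisms. Counting only crossings between strands of I gives a cocycle on B_n whose values on
P_n are inner, and F_2 has trivial centre, so they lift to F_2. For |I| = 4 the two outer crossings
act alike, as under the surjection B_4 → B_3. Uniqueness holds because the `A_{r,s}` generate P_n
(`closure_A`). Conjugation by braids identifies all f_I with |I| fixed, up to automorphisms of F_2.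

Relating |I| = 3 to |I| = 4 needs an automorphism of P_n of another kind. Modulo its centre, P_n is
the pure mapping class group of a sphere with n + 1 punctures, and the puncture at infinity may be
exchanged with the last one. Algebraically, Artin's representation is faithful on P_n, its outer
version has the powers of the full twist as kernel, and one linking number detects these. So P_n
embeds in Out(F_n) × ℤ (`outerLinking_injective`), and the exchange `lastFlip` normalizes the image.
The resulting automorphism turns some f_J with |J| = 4 into an f_I with |I| = 3. -/

namespace PureBraid

/-! ### Relations between the band braids `A_{r,s}` -/

section BraidRelations

variable {n : ℕ}

/-- The Artin generator with index `t`, and `1` if there is none. -/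
def sg (n t : ℕ) : BraidGroup n := if h : t < n - 1 then sigma ⟨t, h⟩ else 1

theorem sg_of_lt {t : ℕ} (h : t < n - 1) : sg n t = sigma ⟨t, h⟩ := dif_pos h

theorem sigma_eq_sg (i : Fin (n - 1)) : sigma i = sg n i := (sg_of_lt i.2).symm

theorem sg_braid {t : ℕ} (h : t + 2 < n) :
    sg n t * sg n (t + 1) * sg n t = sg n (t + 1) * sg n t * sg n (t + 1) := by
  rw [sg_of_lt (by omega : t < n - 1), sg_of_lt (by omega : t + 1 < n - 1), ← mul_inv_eq_one]
  exact PresentedGroup.one_of_mem (Or.inl ⟨_, _, rfl, rfl⟩)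

theorem sg_commute {t u : ℕ} (h : t + 2 ≤ u) : Commute (sg n t) (sg n u) := by
  by_cases ht : t < n - 1
  · by_cases hu : u < n - 1
    · rw [sg_of_lt ht, sg_of_lt hu]
      refine Eq.symm ?_
      rw [← mul_inv_eq_one]
      exact PresentedGroup.one_of_mem (Or.inr ⟨_, _, h, rfl⟩)
    · simp [sg, hu]
  · simp [sg, ht]

/-- Induction over the braid group, by left multiplication with generators and their inverses. -/
theorem braid_induction {p : BraidGroup n → Prop} (one : p 1)
    (mul : ∀ t, t + 1 < n → ∀ β, p β → p (sg n t * β))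
    (inv_mul : ∀ t, t + 1 < n → ∀ β, p β → p ((sg n t)⁻¹ * β)) (β : BraidGroup n) : p β := by
  have hβ : β ∈ Subgroup.closure (Set.range (sigma (n := n))) := by
    have : Subgroup.closure (Set.range (sigma (n := n))) = ⊤ :=
      PresentedGroup.closure_range_of (braidRels n)
    rw [this]; trivial
  induction hβ using Subgroup.closure_induction_left with
  | one => exact one
  | mul_left g hg β _ ih =>
    obtain ⟨i, rfl⟩ := hg
    rw [sigma_eq_sg]; exact mul _ (by omega) _ ih
  | inv_mul_cancel g hg β _ ih =>
    obtain ⟨i, rfl⟩ := hg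
    rw [sigma_eq_sg]; exact inv_mul _ (by omega) _ ih

/-- The braid `A_{r,s}`, with indices in `ℕ`. -/
def bd (n r : ℕ) : ℕ → BraidGroup n
  | 0 => 1
  | s + 1 => if r = s then sg n s ^ 2 else sg n s * bd n r s * (sg n s)⁻¹

theorem bd_self_succ (r : ℕ) : bd n r (r + 1) = sg n r ^ 2 := by simp [bd]

theorem bd_succ {r s : ℕ} (h : r < s) : bd n r (s + 1) = sg n s * bd n r s * (sg n s)⁻¹ := by
  simp [bd, h.ne]

theorem sg_commute_bd_of_lt {t r s : ℕ} (h : t + 1 < r) (hrs : r < s) :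
    Commute (sg n t) (bd n r s) := by
  induction s, hrs using Nat.le_induction with
  | base => rw [bd_self_succ]; exact (sg_commute h).pow_right 2
  | succ s hs ih =>
    rw [bd_succ hs]
    have := sg_commute (n := n) (t := t) (u := s) (by omega)
    exact (this.mul_right ih).mul_right this.inv_right

theorem sg_commute_bd_of_gt {t r s : ℕ} (h : s < t) (hrs : r < s) :
    Commute (sg n t) (bd n r s) := by
  induction s, hrs using Nat.le_induction with
  | base => rw [bd_self_succ]; exact (sg_commute (by omega)).symm.pow_right 2
  | succ s hs ih =>
    rw [bd_succ hs]
    have := (sg_commute (n := n) (t := s) (u := t) (by omega)).symm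
    exact (this.mul_right (ih (by omega))).mul_right this.inv_right

/-- Most commutation relations below are obtained by transporting an easier one along a conjugation.
-/
theorem commute_of_semiconjBy {G : Type*} [Group G] {g a b a' b' : G} (h : Commute a b)
    (ha : SemiconjBy g a a') (hb : SemiconjBy g b b') : Commute a' b' := by
  have ha' : a' = g * a * g⁻¹ := by rw [ha.eq]; group
  have hb' : b' = g * b * g⁻¹ := by rw [hb.eq]; group
  rw [ha', hb']
  exact h.map (MulAut.conj g).toMonoidHom

theorem SemiconjBy.cancel_left {G : Type*} [Group G] {g h a b c : G} (h₁ : SemiconjBy h a b)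
    (h₂ : SemiconjBy (g * h) a c) : SemiconjBy g b c := by
  simpa using h₂.mul_left h₁.inv_symm_left

theorem sg_mul_sg_semiconjBy {t : ℕ} (h : t + 2 < n) :
    SemiconjBy (sg n t * sg n (t + 1)) (sg n t) (sg n (t + 1)) := by
  rw [SemiconjBy, sg_braid h]; group

theorem sg_mul_sg_semiconjBy' {t : ℕ} (h : t + 2 < n) :
    SemiconjBy (sg n (t + 1) * sg n t) (sg n (t + 1)) (sg n t) := by
  rw [SemiconjBy, ← sg_braid h]; group

theorem sg_semiconjBy_bd_succ {r s : ℕ} (h : r < s) :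
    SemiconjBy (sg n s) (bd n r s) (bd n r (s + 1)) := by
  rw [bd_succ h, SemiconjBy]; group

theorem sg_commute_bd_of_between {t r s : ℕ} (h : r < t) (hts : t + 1 < s) (hs : s < n) :
    Commute (sg n t) (bd n r s) := by
  induction s, hts using Nat.le_induction with
  | base =>
    exact commute_of_semiconjBy (sg_commute_bd_of_gt (by omega) h)
      (sg_mul_sg_semiconjBy' (by omega))
      ((sg_semiconjBy_bd_succ (by omega)).mul_left (sg_semiconjBy_bd_succ h))
  | succ s hts ih =>
    exact commute_of_semiconjBy (ih (by omega)) (sg_commute (n := n) hts).symm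
      (sg_semiconjBy_bd_succ (by omega))

theorem sg_commute_bd_self {r : ℕ} : Commute (sg n r) (bd n r (r + 1)) := by
  rw [bd_self_succ]; exact (Commute.refl _).pow_right 2

theorem sg_semiconjBy_bd_left {r s : ℕ} (h : r + 1 < s) (hs : s < n) :
    SemiconjBy (sg n r) (bd n r s) (bd n (r + 1) s) := by
  induction s, h using Nat.le_induction with
  | base =>
    refine SemiconjBy.cancel_left (sg_semiconjBy_bd_succ (by omega)) ?_
    rw [bd_self_succ, bd_self_succ]
    exact (sg_mul_sg_semiconjBy hs).pow_right 2
  | succ s h ih =>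
    have := sg_commute (n := n) (t := r) (u := s) (by omega)
    rw [bd_succ (by omega), bd_succ (by omega)]
    exact (SemiconjBy.mul_right this (ih (by omega))).mul_right this.inv_right

/-- How conjugation by a generator acts on the braids `A_{r,s}`. -/
theorem sg_bd_cases {t r s : ℕ} (ht : t + 1 < n) (hrs : r < s) (hs : s < n) :
    Commute (sg n t) (bd n r s) ∨ ∃ r' s', r' < s' ∧ s' < n ∧
      (SemiconjBy (sg n t) (bd n r s) (bd n r' s') ∨
        SemiconjBy (sg n t) (bd n r' s') (bd n r s)) := by
  rcases lt_trichotomy t r with h | rfl | h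
  · rcases (show t + 1 ≤ r from h).lt_or_eq with h | rfl
    · exact Or.inl (sg_commute_bd_of_lt h hrs)
    · exact Or.inr ⟨t, s, by omega, hs, Or.inr (sg_semiconjBy_bd_left hrs hs)⟩
  · rcases (show t + 1 ≤ s from hrs).lt_or_eq with h | rfl
    · exact Or.inr ⟨t + 1, s, h, hs, Or.inl (sg_semiconjBy_bd_left h hs)⟩
    · exact Or.inl sg_commute_bd_self
  · rcases lt_trichotomy t s with h' | rfl | h'
    · rcases (show t + 1 ≤ s from h').lt_or_eq with h' | rfl
      · exact Or.inl (sg_commute_bd_of_between h h' hs)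
      · exact Or.inr ⟨r, t, h, by omega, Or.inr (sg_semiconjBy_bd_succ h)⟩
    · exact Or.inr ⟨r, t + 1, by omega, ht, Or.inl (sg_semiconjBy_bd_succ hrs)⟩
    · exact Or.inl (sg_commute_bd_of_gt h' hrs)

/-- In the product the strand m encircles the adjacent strands t and t + 1 together, so a crossing
of those two slides through. -/
theorem sg_commute_bd_mul_bd {t m : ℕ} (h : t + 1 < m) (hm : m < n) :
    Commute (sg n t) (bd n t m * bd n (t + 1) m) := by
  induction m, h using Nat.le_induction with
  | base =>
    have h1 := sg_braid (n := n) hm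
    have h2 : bd n t (t + 1 + 1) * bd n (t + 1) (t + 1 + 1)
        = sg n (t + 1) * sg n t * sg n t * sg n (t + 1) := by
      rw [bd_succ (by omega), bd_self_succ, bd_self_succ]; simp [pow_two, mul_assoc]
    rw [h2]
    show _ = _
    calc sg n t * (sg n (t + 1) * sg n t * sg n t * sg n (t + 1))
        = (sg n t * sg n (t + 1) * sg n t) * sg n t * sg n (t + 1) := by group
      _ = sg n (t + 1) * sg n t * (sg n (t + 1) * sg n t * sg n (t + 1)) := by rw [h1]; group
      _ = _ := by rw [← h1]; group
  | succ m h ih =>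
    exact commute_of_semiconjBy (ih (by omega)) (sg_commute (n := n) h).symm
      ((sg_semiconjBy_bd_succ (by omega)).mul_right (sg_semiconjBy_bd_succ (by omega)))

theorem commute_bd_of_forall {x : BraidGroup n} {t u : ℕ} (htu : t < u)
    (h : ∀ v, t ≤ v → v < u → Commute x (sg n v)) : Commute x (bd n t u) := by
  induction u, htu using Nat.le_induction with
  | base => rw [bd_self_succ]; exact (h t le_rfl (by omega)).pow_right 2
  | succ u htu ih =>
    have h1 := h u (by omega) (by omega)
    rw [bd_succ htu]
    exact (h1.mul_right (ih fun v hv hv' => h v hv (by omega))).mul_right h1.inv_right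

theorem bd_commute_of_lt {r s t u : ℕ} (hrs : r < s) (hst : s < t) (htu : t < u) :
    Commute (bd n r s) (bd n t u) :=
  commute_bd_of_forall htu fun _ hv _ => (sg_commute_bd_of_gt (by omega) hrs).symm

theorem bd_commute_of_nested {r s t u : ℕ} (hrt : r < t) (htu : t < u) (hus : u < s)
    (hs : s < n) : Commute (bd n r s) (bd n t u) :=
  commute_bd_of_forall htu fun _ _ _ => (sg_commute_bd_of_between (by omega) (by omega) hs).symm

/-- For l = k + 1 this is the nested relation between `A_{i,k+1}` and `A_{j,k}` conjugated by the
inverse of σ_k. The conjugating factor appears because that inverse differs from σ_k by the square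
`A_{k,k+1}`. -/
theorem bd_commute_of_interlaced {i j k l : ℕ} (hij : i < j) (hjk : j < k) (hkl : k < l)
    (hl : l < n) : Commute (bd n i k) ((bd n k l)⁻¹ * bd n j l * bd n k l) := by
  induction l, hkl using Nat.le_induction with
  | base =>
    have h1 := bd_commute_of_nested (n := n) hij hjk (Nat.lt_succ_self k) hl
    refine commute_of_semiconjBy h1 (sg_semiconjBy_bd_succ (by omega)).inv_symm_left ?_
    rw [bd_self_succ, bd_succ hjk, SemiconjBy]; group
  | succ l hkl ih =>
    refine commute_of_semiconjBy (ih (by omega))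
      (sg_commute_bd_of_gt (t := l) (r := i) (s := k) (by omega) (by omega)) ?_
    exact ((sg_semiconjBy_bd_succ (by omega)).inv_right.mul_right
      (sg_semiconjBy_bd_succ (by omega))).mul_right (sg_semiconjBy_bd_succ (by omega))

/-- Together these say that the product `A_{i,j} A_{i,k} A_{j,k}`, the full twist on three strands,
commutes with each of its factors. -/
theorem bd_triple {i j k : ℕ} (hij : i < j) (hjk : j < k) (hk : k < n) :
    Commute (bd n i j) (bd n i k * bd n j k) ∧ Commute (bd n j k) (bd n i j * bd n i k) := by
  induction j, hij using Nat.le_induction with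
  | base =>
    refine ⟨?_, ?_⟩
    · rw [bd_self_succ]
      exact (sg_commute_bd_mul_bd hjk hk).pow_left 2
    · induction k, hjk using Nat.le_induction with
      | base =>
        have h1 := sg_braid (n := n) hk
        have h2 : bd n i (i + 1) * bd n i (i + 1 + 1)
            = sg n i * sg n (i + 1) * sg n (i + 1) * sg n i := by
          rw [bd_succ (Nat.lt_succ_self i), bd_self_succ]
          calc sg n i ^ 2 * (sg n (i + 1) * sg n i ^ 2 * (sg n (i + 1))⁻¹)
              = sg n i * (sg n i * sg n (i + 1) * sg n i) * sg n i * (sg n (i + 1))⁻¹ := by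
                simp only [pow_two, mul_assoc]
            _ = sg n i * sg n (i + 1) * (sg n i * sg n (i + 1) * sg n i) * (sg n (i + 1))⁻¹ := by
              nth_rewrite 1 [h1]; group
            _ = _ := by rw [h1]; group
        rw [h2, bd_self_succ]
        refine Commute.pow_left ?_ 2
        show _ = _
        calc sg n (i + 1) * (sg n i * sg n (i + 1) * sg n (i + 1) * sg n i)
            = (sg n (i + 1) * sg n i * sg n (i + 1)) * sg n (i + 1) * sg n i := by group
          _ = sg n i * sg n (i + 1) * (sg n i * sg n (i + 1) * sg n i) := by rw [← h1]; group
          _ = _ := by rw [h1]; group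
      | succ k hik ih =>
        exact commute_of_semiconjBy (ih (by omega)) (sg_semiconjBy_bd_succ (by omega))
          (SemiconjBy.mul_right (sg_commute_bd_of_gt (by omega) (by omega))
            (sg_semiconjBy_bd_succ (by omega)))
  | succ j hij ih =>
    obtain ⟨h1, h2⟩ := ih (by omega)
    have h3 := sg_semiconjBy_bd_succ (n := n) hij
    have h4 : SemiconjBy (sg n j) (bd n i k) (bd n i k) :=
      sg_commute_bd_of_between (by omega) (by omega) hk
    have h5 := sg_semiconjBy_bd_left hjk hk
    exact ⟨commute_of_semiconjBy h1 h3 (h4.mul_right h5),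
      commute_of_semiconjBy h2 h5 (h3.mul_right h4)⟩

/-- A single braid moves all three bands at once, which reduces the study of a triple of strands to
0, 1, 2. -/
theorem exists_semiconjBy_bd {i j k : ℕ} (hij : i < j) (hjk : j < k) (hk : k < n) :
    ∃ β : BraidGroup n, SemiconjBy β (bd n 0 1) (bd n i j) ∧
      SemiconjBy β (bd n 0 2) (bd n i k) ∧ SemiconjBy β (bd n 1 2) (bd n j k) := by
  induction i with
  | zero =>
    induction j, hij using Nat.le_induction with
    | base =>
      induction k, hjk using Nat.le_induction with
      | base => exact ⟨1, SemiconjBy.one_left _, SemiconjBy.one_left _, SemiconjBy.one_left _⟩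
      | succ k hjk ih =>
        obtain ⟨β, h1, h2, h3⟩ := ih (by omega)
        exact ⟨sg n k * β,
          SemiconjBy.mul_left (sg_commute_bd_of_gt (by omega) (by omega)) h1,
          (sg_semiconjBy_bd_succ (by omega)).mul_left h2,
          (sg_semiconjBy_bd_succ (by omega)).mul_left h3⟩
    | succ j hij ih =>
      obtain ⟨β, h1, h2, h3⟩ := ih (by omega)
      exact ⟨sg n j * β, (sg_semiconjBy_bd_succ (by omega)).mul_left h1,
        SemiconjBy.mul_left (sg_commute_bd_of_between (by omega) (by omega) hk) h2,
        (sg_semiconjBy_bd_left hjk hk).mul_left h3⟩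
  | succ i ih =>
    obtain ⟨β, h1, h2, h3⟩ := ih (by omega)
    exact ⟨sg n i * β, (sg_semiconjBy_bd_left hij (by omega)).mul_left h1,
      (sg_semiconjBy_bd_left (by omega) hk).mul_left h2,
      SemiconjBy.mul_left (sg_commute_bd_of_lt (by omega) (by omega)) h3⟩

/-- The subgroup generated by the braids `A_{r,s}`. -/
def bandSubgroup (n : ℕ) : Subgroup (BraidGroup n) :=
  Subgroup.closure {β | ∃ r s, r < s ∧ s < n ∧ β = bd n r s}

theorem bd_mem_bandSubgroup {r s : ℕ} (hrs : r < s) (hs : s < n) : bd n r s ∈ bandSubgroup n :=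
  Subgroup.subset_closure ⟨r, s, hrs, hs, rfl⟩

theorem sg_sq_mem_bandSubgroup {t : ℕ} (ht : t + 1 < n) : sg n t ^ 2 ∈ bandSubgroup n :=
  bd_self_succ (n := n) t ▸ bd_mem_bandSubgroup t.lt_succ_self ht

/-- The relation controls conjugation in one direction only; since g² lies in K, the opposite
direction differs from it by conjugation inside K. -/
theorem conj_mem_of_semiconjBy {G : Type*} [Group G] {K : Subgroup G} {g x y : G}
    (h : SemiconjBy g x y) (hg : g ^ 2 ∈ K) (hx : x ∈ K) (hy : y ∈ K) :
    (g * x * g⁻¹ ∈ K ∧ g⁻¹ * x * g ∈ K) ∧ (g * y * g⁻¹ ∈ K ∧ g⁻¹ * y * g ∈ K) := by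
  have hy' : y = g * x * g⁻¹ := by rw [h.eq]; group
  have e1 : g⁻¹ * x * g = (g ^ 2)⁻¹ * y * g ^ 2 := by rw [hy']; group
  have e2 : g * y * g⁻¹ = g ^ 2 * x * (g ^ 2)⁻¹ := by rw [hy']; simp [pow_two, mul_assoc]
  have e3 : g⁻¹ * y * g = x := by rw [hy']; group
  rw [e1, e2, e3, ← hy']
  exact ⟨⟨hy, K.mul_mem (K.mul_mem (K.inv_mem hg) hy) hg⟩,
    K.mul_mem (K.mul_mem hg hx) (K.inv_mem hg), hx⟩

theorem sg_conj_bd_mem {t r s : ℕ} (ht : t + 1 < n) (hrs : r < s) (hs : s < n) :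
    sg n t * bd n r s * (sg n t)⁻¹ ∈ bandSubgroup n ∧
      (sg n t)⁻¹ * bd n r s * sg n t ∈ bandSubgroup n := by
  have h0 := sg_sq_mem_bandSubgroup ht
  have h1 := bd_mem_bandSubgroup hrs hs
  rcases sg_bd_cases ht hrs hs with h | ⟨r', s', hrs', hs', h | h⟩
  · exact (conj_mem_of_semiconjBy h h0 h1 h1).1
  · exact (conj_mem_of_semiconjBy h h0 h1 (bd_mem_bandSubgroup hrs' hs')).1
  · exact (conj_mem_of_semiconjBy h h0 (bd_mem_bandSubgroup hrs' hs') h1).2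

instance bandSubgroup_normal : (bandSubgroup n).Normal := by
  have key : ∀ g : BraidGroup n, (∀ r s, r < s → s < n → g * bd n r s * g⁻¹ ∈ bandSubgroup n) →
      ∀ x ∈ bandSubgroup n, g * x * g⁻¹ ∈ bandSubgroup n := by
    intro g hg x hx
    have : bandSubgroup n ≤ (bandSubgroup n).comap (MulAut.conj g).toMonoidHom := by
      conv_lhs => rw [bandSubgroup]
      rw [Subgroup.closure_le]
      rintro _ ⟨r, s, hrs, hs, rfl⟩
      exact hg r s hrs hs
    exact this hx
  refine ⟨fun x hx g => ?_⟩
  induction g using braid_induction generalizing x with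
  | one => simpa using hx
  | mul t ht β ih =>
    have := key (sg n t) (fun r s hrs hs => (sg_conj_bd_mem ht hrs hs).1) _ (ih x hx)
    simpa [mul_assoc] using this
  | inv_mul t ht β ih =>
    have := key (sg n t)⁻¹ (fun r s hrs hs => by simpa using (sg_conj_bd_mem ht hrs hs).2) _
      (ih x hx)
    simpa [mul_assoc] using this

end BraidRelations

/-! ### Generation of the pure braid group by the `A_{r,s}` -/

section Generation

variable {n : ℕ}

theorem coe_A {r s : Fin n} (h : r < s) : (A r s h : BraidGroup n) = bd n r s := by
  have key : ∀ (r d : ℕ) (hd : r + d < n - 1),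
      descProd (n := n) r d hd * sg n r ^ 2 * (descProd r d hd)⁻¹ = bd n r (r + 1 + d) := by
    intro r d
    induction d with
    | zero => intro _; simp [descProd, bd_self_succ]
    | succ d ih =>
      intro hd
      rw [← add_assoc, bd_succ (by omega), ← ih (by omega), descProd,
        sg_of_lt (t := r + 1 + d) (by omega)]
      simp only [show r + 1 + d = r + (d + 1) by omega]
      group
  have hs : (s : ℕ) = r + 1 + (s - r - 1) := by have := Fin.lt_def.mp h; omega
  conv_rhs => rw [hs]
  rw [← key _ _ (by have := Fin.lt_def.mp h; omega)]
  show bandBraid r s h = _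
  rw [bandBraid, sigma_eq_sg]

theorem toPerm_sg {t : ℕ} (h : t + 1 < n) :
    toPerm n (sg n t) = Equiv.swap ⟨t, by omega⟩ ⟨t + 1, h⟩ := by
  rw [sg_of_lt (by omega), toPerm_sigma]; rfl

theorem bandSubgroup_le_ker : bandSubgroup n ≤ (toPerm n).ker := by
  rw [bandSubgroup, Subgroup.closure_le]
  rintro _ ⟨r, s, hrs, hs, rfl⟩
  have := (A (n := n) ⟨r, by omega⟩ ⟨s, hs⟩ hrs).2
  rwa [coe_A] at this

/-- The product `σ_{k+d-1} ⋯ σ_k`. -/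
def descSg (n k : ℕ) : ℕ → BraidGroup n
  | 0 => 1
  | d + 1 => sg n (k + d) * descSg n k d

theorem descSg_succ' (k d : ℕ) : descSg n k (d + 1) = descSg n (k + 1) d * sg n k := by
  induction d with
  | zero => simp [descSg]
  | succ d ih => rw [descSg, ih, descSg, mul_assoc, show k + 1 + d = k + (d + 1) by omega]

theorem descSg_commute_of_lt {i k d : ℕ} (h : i + 1 < k) : Commute (descSg n k d) (sg n i) := by
  induction d with
  | zero => exact Commute.one_left _
  | succ d ih => exact (sg_commute (by omega)).symm.mul_left ih

theorem descSg_commute_of_gt {i k d : ℕ} (h : k + d < i) : Commute (descSg n k d) (sg n i) := by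
  induction d with
  | zero => exact Commute.one_left _
  | succ d ih => exact (sg_commute (by omega)).mul_left (ih (by omega))

theorem descSg_semiconjBy {i k d : ℕ} (hi : k ≤ i) (hid : i + 1 < k + d) (hd : k + d < n) :
    SemiconjBy (descSg n k d) (sg n (i + 1)) (sg n i) := by
  induction d with
  | zero => omega
  | succ d ih =>
    rcases (show i + 1 ≤ k + d by omega).lt_or_eq with h | h
    · exact SemiconjBy.mul_left (sg_commute (n := n) (by omega)).symm (ih h (by omega))
    · obtain ⟨d, rfl⟩ : ∃ e, d = e + 1 := ⟨d - 1, by omega⟩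
      obtain rfl : i = k + d := by omega
      rw [descSg, descSg, ← mul_assoc]
      exact (sg_mul_sg_semiconjBy' (by omega)).mul_left (descSg_commute_of_gt (by omega))

theorem toPerm_descSg {k d : ℕ} (h : k + d < n) :
    toPerm n (descSg n k d) ⟨k, by omega⟩ = ⟨k + d, h⟩ := by
  induction d with
  | zero => simp [descSg]
  | succ d ih =>
    rw [descSg, map_mul, Equiv.Perm.mul_apply, ih (by omega), toPerm_sg (by omega),
      Equiv.swap_apply_left]
    rfl

/-- The class of an Artin generator modulo the subgroup generated by the `A_{r,s}`. -/
def sgMod (n i : ℕ) : BraidGroup n ⧸ bandSubgroup n := QuotientGroup.mk' _ (sg n i)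

theorem sgMod_mul_self {i : ℕ} (h : i + 1 < n) : sgMod n i * sgMod n i = 1 := by
  rw [sgMod, ← map_mul, ← pow_two]
  exact (QuotientGroup.eq_one_iff _).2 (sg_sq_mem_bandSubgroup h)

/-- The subgroup generated by the classes of `σ_0, …, σ_{m-1}`. -/
def sgModSubgroup (n m : ℕ) : Subgroup (BraidGroup n ⧸ bandSubgroup n) :=
  Subgroup.closure {q | ∃ i < m, q = sgMod n i}

/-- Coset normal form as in the symmetric group: modulo the bands the generators are involutions,
and right multiplication by one of them permutes the cosets represented by the descending products.
-/
theorem exists_eq_mul_descSg {m : ℕ} (hm : m + 1 < n) {q : BraidGroup n ⧸ bandSubgroup n}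
    (hq : q ∈ sgModSubgroup n (m + 1)) : ∃ h ∈ sgModSubgroup n m, ∃ k d, k + d = m + 1 ∧
      q = h * QuotientGroup.mk' _ (descSg n k d) := by
  have step : ∀ i < m + 1, ∀ q, (∃ h ∈ sgModSubgroup n m, ∃ k d, k + d = m + 1 ∧
      q = h * QuotientGroup.mk' _ (descSg n k d)) → ∃ h ∈ sgModSubgroup n m, ∃ k d,
        k + d = m + 1 ∧ q * sgMod n i = h * QuotientGroup.mk' _ (descSg n k d) := by
    rintro i hi _ ⟨h, hh, k, d, hkd, rfl⟩
    have mem : ∀ j < m, sgMod n j ∈ sgModSubgroup n m :=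
      fun j hj => Subgroup.subset_closure ⟨j, hj, rfl⟩
    rcases lt_trichotomy (i + 1) k with hik | rfl | hik
    · refine ⟨h * sgMod n i, mul_mem hh (mem i (by omega)), k, d, hkd, ?_⟩
      rw [sgMod, mul_assoc, mul_assoc, ← map_mul, ← map_mul, (descSg_commute_of_lt hik).eq]
    · refine ⟨h, hh, i, d + 1, by omega, ?_⟩
      rw [sgMod, mul_assoc, ← map_mul, descSg_succ']
    · rcases (show k ≤ i by omega).eq_or_lt with rfl | hik
      · obtain ⟨d, rfl⟩ : ∃ e, d = e + 1 := ⟨d - 1, by omega⟩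
        refine ⟨h, hh, k + 1, d, by omega, ?_⟩
        have := sgMod_mul_self (n := n) (i := k) (by omega)
        rw [sgMod] at this ⊢
        rw [descSg_succ', map_mul, mul_assoc, mul_assoc, this, mul_one]
      · obtain ⟨i, rfl⟩ : ∃ e, i = e + 1 := ⟨i - 1, by omega⟩
        refine ⟨h * sgMod n i, mul_mem hh (mem i (by omega)), k, d, hkd, ?_⟩
        rw [sgMod, sgMod, mul_assoc, mul_assoc, ← map_mul, ← map_mul,
          (descSg_semiconjBy (by omega) (by omega) (by omega)).eq]
  induction hq using Subgroup.closure_induction_right with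
  | one => exact ⟨1, one_mem _, m + 1, 0, rfl, by simp [descSg]⟩
  | mul_right q _ x hx ih =>
    obtain ⟨i, hi, rfl⟩ := hx
    exact step i hi q ih
  | mul_inv_cancel q _ x hx ih =>
    obtain ⟨i, hi, rfl⟩ := hx
    rw [inv_eq_of_mul_eq_one_right (sgMod_mul_self (by omega))]
    exact step i hi q ih

/-- The quotient by the bands maps injectively to the symmetric group, by induction on the number of
generators allowed and the coset normal form. -/
theorem bandSubgroup_eq_ker : bandSubgroup n = (toPerm n).ker := by
  refine le_antisymm bandSubgroup_le_ker fun β hβ => ?_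
  let p : BraidGroup n ⧸ bandSubgroup n →* Equiv.Perm (Fin n) :=
    QuotientGroup.lift _ (toPerm n) bandSubgroup_le_ker
  have hp : ∀ γ, p (QuotientGroup.mk' _ γ) = toPerm n γ := fun γ => rfl
  have fix : ∀ m (hm : m + 1 < n), ∀ q ∈ sgModSubgroup n m, p q ⟨m + 1, hm⟩ = ⟨m + 1, hm⟩ := by
    intro m hm q hq
    have : sgModSubgroup n m ≤ (MulAction.stabilizer (Equiv.Perm (Fin n))
        (⟨m + 1, hm⟩ : Fin n)).comap p := by
      rw [sgModSubgroup, Subgroup.closure_le]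
      rintro _ ⟨i, hi, rfl⟩
      show p (sgMod n i) ⟨m + 1, hm⟩ = _
      rw [sgMod, hp, toPerm_sg (by omega)]
      exact Equiv.swap_apply_of_ne_of_ne (by simp; omega) (by simp; omega)
    exact this hq
  have main : ∀ m, m < n → ∀ q ∈ sgModSubgroup n m, p q = 1 → q = 1 := by
    intro m
    induction m with
    | zero =>
      intro _ q hq _
      have : sgModSubgroup n 0 = ⊥ := by
        rw [sgModSubgroup, Subgroup.closure_eq_bot_iff]
        rintro _ ⟨i, hi, _⟩
        omega
      rwa [this, Subgroup.mem_bot] at hq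
    | succ m ih =>
      intro hm q hq hpq
      obtain ⟨h, hh, k, d, hkd, rfl⟩ := exists_eq_mul_descSg hm hq
      -- The coset representative sends k to m + 1, which h fixes; a trivial permutation therefore
      -- forces k = m + 1, so d = 0.
      have h1 := DFunLike.congr_fun hpq ⟨k, by omega⟩
      rw [map_mul, Equiv.Perm.mul_apply, hp, toPerm_descSg (by omega)] at h1
      simp only [hkd, fix m hm h hh, Equiv.Perm.one_apply, Fin.mk.injEq] at h1
      obtain rfl : d = 0 := by omega
      simp only [descSg, map_one, mul_one] at hpq ⊢
      exact ih (by omega) h hh hpq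
  rw [← QuotientGroup.eq_one_iff]
  rcases Nat.eq_zero_or_pos n with rfl | hn
  · induction β using braid_induction with
    | one => rfl
    | mul t ht => omega
    | inv_mul t ht => omega
  · refine main (n - 1) (by omega) _ ?_ hβ
    clear hβ
    have mem : ∀ t, t + 1 < n → sgMod n t ∈ sgModSubgroup n (n - 1) :=
      fun t ht => Subgroup.subset_closure ⟨t, by omega, rfl⟩
    induction β using braid_induction with
    | one => exact one_mem _
    | mul t ht β ih => exact mul_mem (mem t ht) ih
    | inv_mul t ht β ih => exact mul_mem (inv_mem (mem t ht)) ih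

/-- The pure braid group is generated by the `A_{r,s}`. -/
theorem closure_A : Subgroup.closure {a : PureBraidGroup n | ∃ r s h, a = A r s h} = ⊤ := by
  rw [eq_top_iff]
  rintro ⟨β, hβ⟩ -
  have h1 : (Subgroup.closure {a : PureBraidGroup n | ∃ r s h, a = A r s h}).map
      (toPerm n).ker.subtype = bandSubgroup n := by
    rw [MonoidHom.map_closure, bandSubgroup]
    congr 1
    ext γ
    constructor
    · rintro ⟨_, ⟨r, s, h, rfl⟩, rfl⟩
      exact ⟨r, s, h, s.2, coe_A h⟩
    · rintro ⟨r, s, hrs, hs, rfl⟩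
      exact ⟨_, ⟨⟨r, by omega⟩, ⟨s, hs⟩, hrs, rfl⟩, coe_A (Fin.mk_lt_mk.2 hrs)⟩
  rw [← bandSubgroup_eq_ker, ← h1] at hβ
  obtain ⟨a, ha, hab⟩ := hβ
  rwa [show (⟨β, _⟩ : PureBraidGroup n) = a from Subtype.ext hab.symm]

theorem hom_ext_A {G : Type*} [Group G] {f g : PureBraidGroup n →* G}
    (h : ∀ r s hrs, f (A r s hrs) = g (A r s hrs)) : f = g :=
  MonoidHom.eq_of_eqOn_dense closure_A (by rintro _ ⟨r, s, hrs, rfl⟩; exact h r s hrs)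

end Generation

/-! ### Cocycles on the braid group and the homomorphisms they induce on pure braids -/

section Cocycles

open scoped Pointwise

variable {n : ℕ}

/-- A family of elements of `M`, one for each Artin generator and each point of a set on which the
symmetric group acts, that satisfies the braid relations as a cocycle. -/
structure BraidCocycle (n : ℕ) (Ω M : Type*) [MulAction (Equiv.Perm (Fin n)) Ω] [Group M] where
  /-- The value at a generator and a point. -/
  val : Fin (n - 1) → Ω → M
  braid : ∀ i j : Fin (n - 1), (i : ℕ) + 1 = j → ∀ ω,
    val i (adjSwap j • adjSwap i • ω) * val j (adjSwap i • ω) * val i ω =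
      val j (adjSwap i • adjSwap j • ω) * val i (adjSwap j • ω) * val j ω
  comm : ∀ i j : Fin (n - 1), (i : ℕ) + 2 ≤ j → ∀ ω,
    val j (adjSwap i • ω) * val i ω = val i (adjSwap j • ω) * val j ω

namespace BraidCocycle

variable {Ω M : Type*} [MulAction (Equiv.Perm (Fin n)) Ω] [Group M] (c : BraidCocycle n Ω M)

/-- The permutation of `Ω × M` attached to a generator. -/
def genPerm (i : Fin (n - 1)) : Equiv.Perm (Ω × M) where
  toFun a := (adjSwap i • a.1, c.val i a.1 * a.2)
  invFun a := ((adjSwap i)⁻¹ • a.1, (c.val i ((adjSwap i)⁻¹ • a.1))⁻¹ * a.2)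
  left_inv a := by simp
  right_inv a := by simp

theorem genPerm_inv_apply (i : Fin (n - 1)) (a : Ω × M) : (c.genPerm i)⁻¹ a =
    ((adjSwap i)⁻¹ • a.1, (c.val i ((adjSwap i)⁻¹ • a.1))⁻¹ * a.2) := rfl

theorem genPerm_rels (w : FreeGroup (Fin (n - 1))) (hw : w ∈ braidRels n) :
    FreeGroup.lift c.genPerm w = 1 := by
  have hperm := adjSwap_rels w hw
  rcases hw with ⟨i, j, hij, rfl⟩ | ⟨i, j, hij, rfl⟩
  · simp only [map_mul, map_inv, FreeGroup.lift_apply_of] at hperm ⊢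
    rw [mul_inv_eq_one] at hperm ⊢
    ext1 ⟨ω, m⟩
    refine Prod.ext ?_ ?_
    · simpa [genPerm, mul_smul] using congrArg (fun p => p • ω) hperm
    · simpa [genPerm, mul_assoc] using congrArg (fun p => p * m) (c.braid i j hij ω)
  · simp only [map_mul, map_inv, FreeGroup.lift_apply_of] at hperm ⊢
    rw [mul_inv_eq_one] at hperm ⊢
    ext1 ⟨ω, m⟩
    refine Prod.ext ?_ ?_
    · simpa [genPerm, mul_smul] using congrArg (fun p => p • ω) hperm
    · simpa [genPerm, mul_assoc] using congrArg (fun p => p * m) (c.comm i j hij ω)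

/-- The action of the braid group on `Ω × M`. -/
def action : BraidGroup n →* Equiv.Perm (Ω × M) := PresentedGroup.toGroup c.genPerm_rels

/-- The value of the cocycle at a braid and a point. -/
def ext (β : BraidGroup n) (ω : Ω) : M := (c.action β (ω, 1)).2

theorem action_sigma (i : Fin (n - 1)) : c.action (sigma i) = c.genPerm i :=
  PresentedGroup.toGroup.of c.genPerm_rels

/-- Generators act on the second factor by left multiplication, so the action commutes with right
multiplication by M and is determined by its values at 1. -/
theorem action_apply (β : BraidGroup n) (ω : Ω) (m : M) :
    c.action β (ω, m) = (toPerm n β • ω, c.ext β ω * m) := by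
  have key : ∀ ω, (c.action β (ω, 1)).1 = toPerm n β • ω ∧
      ∀ m, c.action β (ω, m) = ((c.action β (ω, 1)).1, (c.action β (ω, 1)).2 * m) := by
    induction β using braid_induction with
    | one => simp
    | mul t ht β ih =>
      intro ω
      obtain ⟨h1, h2⟩ := ih ω
      rw [sg_of_lt (by omega)]
      refine ⟨?_, fun m => ?_⟩
      · rw [map_mul, map_mul, action_sigma, toPerm_sigma, mul_smul, ← h1]; rfl
      · rw [map_mul, action_sigma, Equiv.Perm.mul_apply, Equiv.Perm.mul_apply, h2 m]
        simp [genPerm, mul_assoc]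
    | inv_mul t ht β ih =>
      intro ω
      obtain ⟨h1, h2⟩ := ih ω
      rw [sg_of_lt (by omega)]
      refine ⟨?_, fun m => ?_⟩
      · rw [map_mul, map_mul, map_inv, map_inv, action_sigma, toPerm_sigma, mul_smul, ← h1]; rfl
      · rw [map_mul, map_inv, action_sigma, Equiv.Perm.mul_apply, Equiv.Perm.mul_apply, h2 m]
        simp [genPerm_inv_apply, mul_assoc]
  rw [(key ω).2 m, (key ω).1]; rfl

theorem ext_mul (β γ : BraidGroup n) (ω : Ω) :
    c.ext (β * γ) ω = c.ext β (toPerm n γ • ω) * c.ext γ ω := by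
  have h : c.action (β * γ) (ω, 1) = c.action β (c.action γ (ω, 1)) := by rw [map_mul]; rfl
  rw [action_apply, action_apply c γ, action_apply] at h
  simpa using congrArg Prod.snd h

theorem ext_one (ω : Ω) : c.ext 1 ω = 1 := by simp [ext]

theorem ext_inv (β : BraidGroup n) (ω : Ω) :
    c.ext β⁻¹ ω = (c.ext β ((toPerm n β)⁻¹ • ω))⁻¹ := by
  have := c.ext_mul β β⁻¹ ω
  rw [mul_inv_cancel, ext_one, map_inv] at this
  exact (inv_eq_of_mul_eq_one_right this.symm).symm

theorem ext_sg {t : ℕ} (h : t < n - 1) (ω : Ω) : c.ext (sg n t) ω = c.val ⟨t, h⟩ ω := by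
  rw [sg_of_lt h, ext, action_sigma]; simp [genPerm]

theorem ext_conj (β γ : BraidGroup n) (hγ : toPerm n γ = 1) (ω : Ω) :
    c.ext (β * γ * β⁻¹) ω = c.ext β ((toPerm n β)⁻¹ • ω) * c.ext γ ((toPerm n β)⁻¹ • ω) *
      (c.ext β ((toPerm n β)⁻¹ • ω))⁻¹ := by
  rw [ext_mul, ext_mul, ext_inv, hγ, one_smul, map_inv]

/-- The cocycle is a homomorphism on pure braids. -/
def pure (ω : Ω) : PureBraidGroup n →* M where
  toFun β := c.ext β ω
  map_one' := c.ext_one ω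
  map_mul' β γ := by
    rw [Subgroup.coe_mul, ext_mul, MonoidHom.mem_ker.1 γ.2, one_smul]

end BraidCocycle

theorem toPerm_bd {r s : ℕ} (hrs : r < s) (hs : s < n) : toPerm n (bd n r s) = 1 :=
  MonoidHom.mem_ker.1 (bandSubgroup_eq_ker (n := n) ▸ bd_mem_bandSubgroup hrs hs)

theorem adjSwap_inv (i : Fin (n - 1)) : (adjSwap i)⁻¹ = adjSwap i := Equiv.swap_inv _ _

theorem adjSwap_lt_iff {t : Fin (n - 1)} {i : ℕ} (h : i ≠ t + 1) (a : Fin n) :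
    (adjSwap t a : ℕ) < i ↔ (a : ℕ) < i := by
  simp only [adjSwap, Equiv.swap_apply_def, Fin.ext_iff]
  split_ifs <;> simp <;> omega

namespace BraidCocycle

variable {Ω M : Type*} [MulAction (Equiv.Perm (Fin n)) Ω] [Group M] (c : BraidCocycle n Ω M)

theorem ext_bd_self {r : ℕ} (h : r < n - 1) (ω : Ω) :
    c.ext (bd n r (r + 1)) ω = c.val ⟨r, h⟩ (adjSwap ⟨r, h⟩ • ω) * c.val ⟨r, h⟩ ω := by
  rw [bd_self_succ, pow_two, ext_mul, sg_of_lt h, toPerm_sigma, sigma_eq_sg, ext_sg, ext_sg]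

theorem ext_bd_succ {r s : ℕ} (hrs : r < s) (h : s < n - 1) (ω : Ω) :
    c.ext (bd n r (s + 1)) ω = c.val ⟨s, h⟩ (adjSwap ⟨s, h⟩ • ω) *
      c.ext (bd n r s) (adjSwap ⟨s, h⟩ • ω) * (c.val ⟨s, h⟩ (adjSwap ⟨s, h⟩ • ω))⁻¹ := by
  rw [bd_succ hrs, ext_conj _ _ _ (toPerm_bd hrs (by omega)), ext_sg c h, sg_of_lt h,
    toPerm_sigma, adjSwap_inv]

end BraidCocycle

/-- The number of elements of `I` below `t`. -/
def countBelow (I : Finset (Fin n)) (t : ℕ) : ℕ := (I.filter fun a : Fin n => (a : ℕ) < t).card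

theorem countBelow_adjSwap (I : Finset (Fin n)) (t : Fin (n - 1)) {i : ℕ} (h : i ≠ t + 1) :
    countBelow (adjSwap t • I) i = countBelow I i := by
  rw [countBelow, countBelow, ← Finset.card_smul_finset (adjSwap t) (I.filter fun a : Fin n => (a : ℕ) < i)]
  congr 1
  ext a
  simp only [Finset.mem_filter, ← Finset.inv_smul_mem_iff, adjSwap_inv, Equiv.Perm.smul_def,
    adjSwap_lt_iff h]

theorem countBelow_succ (I : Finset (Fin n)) (t : Fin n) :
    countBelow I (t + 1) = countBelow I t + if t ∈ I then 1 else 0 := by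
  have h : (I.filter fun a : Fin n => (a : ℕ) < t + 1) =
      (I.filter fun a : Fin n => (a : ℕ) < t) ∪ I.filter fun a : Fin n => a = t := by
    ext a
    have : (a : ℕ) < t + 1 ↔ (a : ℕ) < t ∨ (a : ℕ) = t := by omega
    simp only [Finset.mem_filter, Finset.mem_union, Fin.ext_iff, this, and_or_left]
  rw [countBelow, countBelow, h, Finset.card_union_of_disjoint, Finset.filter_eq']
  · split_ifs <;> simp
  · rw [Finset.disjoint_left]
    simp only [Finset.mem_filter, Fin.ext_iff]; omega

end Cocycles

/-! ### Free groups: centralizers, residual finiteness, the Hopf property, rank -/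

section FreeGroups

universe u

/-- An element of a free group commuting with a free generator is a power of it. -/
theorem mem_zpowers_of_commute_of {α : Type*} (a : α) (g : FreeGroup α)
    (h : Commute g (FreeGroup.of a)) : g ∈ Subgroup.zpowers (FreeGroup.of a) := by
  classical
  induction hn : g.norm using Nat.strong_induction_on generalizing g with
  | _ N ih =>
  rcases hL : g.toWord with _ | ⟨⟨b, e⟩, L⟩
  · rw [FreeGroup.toWord_eq_nil_iff] at hL
    rw [hL]; exact one_mem _
  have hg : g = FreeGroup.mk ((b, e) :: L) := by rw [← hL, FreeGroup.mk_toWord]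
  -- If the reduced word of g starts with a power of a, that letter can be stripped and the
  -- induction on length applies.
  by_cases hb : b = a
  · subst hb
    have key : ∀ u ∈ Subgroup.zpowers (FreeGroup.of b), u * g = FreeGroup.mk L →
        g ∈ Subgroup.zpowers (FreeGroup.of b) := by
      intro u hu hug
      have hc : Commute u (FreeGroup.of b) := by
        obtain ⟨k, rfl⟩ := hu
        exact (Commute.refl _).zpow_left k
      have := ih (FreeGroup.mk L).norm (lt_of_le_of_lt FreeGroup.norm_mk_le (by
        rw [← hn, FreeGroup.norm, hL]; simp)) (FreeGroup.mk L) (hug ▸ hc.mul_left h) rfl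
      rw [← hug] at this
      exact (Subgroup.mul_mem_cancel_left _ hu).1 this
    have hsplit : g = FreeGroup.mk [(b, e)] * FreeGroup.mk L := by
      rw [hg, FreeGroup.mul_mk]; rfl
    cases e
    · refine key (FreeGroup.of b) (Subgroup.mem_zpowers _) ?_
      rw [hsplit, show FreeGroup.mk [(b, false)] = (FreeGroup.of b)⁻¹ from rfl, mul_inv_cancel_left]
    · refine key (FreeGroup.of b)⁻¹ (inv_mem (Subgroup.mem_zpowers _)) ?_
      rw [hsplit, show FreeGroup.mk [(b, true)] = FreeGroup.of b from rfl, inv_mul_cancel_left]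
  -- Otherwise `a * g` is reduced and starts with a. By length, `g * a` is also reduced, and it
  -- starts with b.
  · exfalso
    have hred : FreeGroup.IsReduced ((b, e) :: L) := hL ▸ FreeGroup.isReduced_toWord
    have h1 : (FreeGroup.of a * g).toWord = (a, true) :: (b, e) :: L := by
      rw [hg, FreeGroup.of, FreeGroup.mul_mk, FreeGroup.toWord_mk]
      exact FreeGroup.IsReduced.reduce_eq (L := (a, true) :: (b, e) :: L)
        (FreeGroup.isReduced_cons_cons.2 ⟨fun hh => absurd hh.symm hb, hred⟩)
    have h2 : (g * FreeGroup.of a).toWord = (b, e) :: L ++ [(a, true)] := by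
      have hs := FreeGroup.toWord_mul_sublist g (FreeGroup.of a)
      rw [hL, FreeGroup.toWord_of] at hs
      apply hs.eq_of_length
      rw [h.eq, h1]; simp
    rw [h.eq, h1] at h2
    simp at h2
    exact hb h2.1.1.symm

/-- Such an element is a power of both generators, and the exponent sum in a shows the exponent to
be zero. -/
theorem eq_one_of_commute_of_commute {α : Type*} {a b : α} (hab : a ≠ b) {g : FreeGroup α}
    (ha : Commute g (FreeGroup.of a)) (hb : Commute g (FreeGroup.of b)) : g = 1 := by
  classical
  obtain ⟨k, rfl⟩ := mem_zpowers_of_commute_of a g ha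
  obtain ⟨l, hl⟩ := mem_zpowers_of_commute_of b _ hb
  have := congrArg (FreeGroup.lift fun c => if c = a then Multiplicative.ofAdd (1 : ℤ) else 1) hl
  simp [hab.symm] at this
  have hk : k = 0 := by
    have := congrArg Multiplicative.toAdd this
    simpa using this.symm
  simp [hk]

/-- Commutation is transitive on the nontrivial elements of a free group. -/
theorem commute_trans_of_isFreeGroup {G : Type*} [Group G] [IsFreeGroup G] {a b c : G} (hb : b ≠ 1)
    (hab : Commute a b) (hbc : Commute b c) : Commute a c := by
  -- By Nielsen–Schreier this centralizer is free. It has the nontrivial central element b, so its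
  -- rank is at most one and it is abelian.
  let H := Subgroup.centralizer {b}
  have hH : ∀ {g : G}, Commute g b → g ∈ H := fun h => Subgroup.mem_centralizer_singleton_iff.2 h.eq
  let e := IsFreeGroup.toFreeGroup H
  have hcen : ∀ h : H, Commute (⟨b, hH (Commute.refl b)⟩ : H) h := by
    intro h
    ext
    exact (Subgroup.mem_centralizer_singleton_iff.1 h.2).symm
  have hsub : Subsingleton (IsFreeGroup.Generators H) := by
    by_contra hns
    rw [not_subsingleton_iff_nontrivial] at hns
    obtain ⟨u, v, huv⟩ := hns.exists_pair_ne
    have hcom : ∀ w, Commute (e ⟨b, hH (Commute.refl b)⟩) w := fun w => by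
      simpa using (hcen (e.symm w)).map e.toMonoidHom
    have := eq_one_of_commute_of_commute huv (hcom _) (hcom _)
    rw [map_eq_one_iff e e.injective] at this
    exact hb (congrArg Subtype.val this)
  have hcomm : ∀ p q : FreeGroup (IsFreeGroup.Generators H), Commute p q := by
    intro p q
    rcases isEmpty_or_nonempty (IsFreeGroup.Generators H) with hE | ⟨⟨u⟩⟩
    · exact (Subsingleton.elim p q) ▸ Commute.refl p
    · have hall : ∀ p : FreeGroup (IsFreeGroup.Generators H),
          Commute p (FreeGroup.of u) := by
        intro p
        induction p using FreeGroup.induction_on with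
        | C1 => exact Commute.one_left _
        | of x => rw [Subsingleton.elim x u]
        | inv_of x h => exact h.inv_left
        | mul x y hx hy => exact hx.mul_left hy
      obtain ⟨k, rfl⟩ := mem_zpowers_of_commute_of u p (hall p)
      exact ((hall q).zpow_right k).symm
  have := (hcomm (e ⟨a, hH hab⟩) (e ⟨c, hH hbc.symm⟩)).map (H.subtype.comp e.symm.toMonoidHom)
  simpa using this

/-- Residual finiteness. Left multiplication by a generator is a partial injection of the finite set
of suffixes of w; extending each of these to a permutation gives an action in which w moves 1 to w.
-/
theorem exists_finite_quotient_ne_one {α : Type u} (w : FreeGroup α) (hw : w ≠ 1) :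
    ∃ (S : Type u) (_ : Finite S) (φ : FreeGroup α →* Equiv.Perm S), φ w ≠ 1 := by
  classical
  let T : Finset (FreeGroup α) := (w.toWord.tails.map FreeGroup.mk).toFinset
  have hT : ∀ L, FreeGroup.mk L ∈ T ↔ ∃ L', L' <:+ w.toWord ∧ FreeGroup.mk L' = FreeGroup.mk L := by
    intro L; simp [T]
  let eq (a : α) : {g : T // FreeGroup.of a * g.1 ∈ T} ≃ {g : T // (FreeGroup.of a)⁻¹ * g.1 ∈ T} :=
    { toFun := fun g => ⟨⟨_, g.2⟩, by simp⟩
      invFun := fun g => ⟨⟨_, g.2⟩, by simp⟩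
      left_inv := fun g => by ext; simp
      right_inv := fun g => by ext; simp }
  let φ : FreeGroup α →* Equiv.Perm T := FreeGroup.lift fun a => (eq a).extendSubtype
  refine ⟨T, inferInstance, φ, fun h1 => ?_⟩
  have hφ : ∀ (a : α) (g : T) (h : FreeGroup.of a * g.1 ∈ T), φ (FreeGroup.of a) g = ⟨_, h⟩ := by
    intro a g h
    simp only [φ, FreeGroup.lift_apply_of]
    exact Equiv.extendSubtype_apply_of_mem (eq a) g h
  have h1T : (1 : FreeGroup α) ∈ T := by
    rw [FreeGroup.one_eq_mk, hT]; exact ⟨[], List.nil_suffix, rfl⟩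
  have key : ∀ L, L <:+ w.toWord → ∃ h : FreeGroup.mk L ∈ T,
      φ (FreeGroup.mk L) ⟨1, h1T⟩ = ⟨FreeGroup.mk L, h⟩ := by
    intro L
    induction L with
    | nil => exact fun _ => ⟨h1T, by simp [← FreeGroup.one_eq_mk]⟩
    | cons p L ih =>
      intro hs
      obtain ⟨h, hL⟩ := ih ((List.suffix_cons p L).trans hs)
      have hm : FreeGroup.mk (p :: L) ∈ T := (hT _).2 ⟨_, hs, rfl⟩
      refine ⟨hm, ?_⟩
      have hsplit : FreeGroup.mk (p :: L) = FreeGroup.mk [p] * FreeGroup.mk L := by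
        rw [FreeGroup.mul_mk]; rfl
      simp only [hsplit, map_mul, Equiv.Perm.mul_apply, hL]
      obtain ⟨a, _ | _⟩ := p
      · have hinv : FreeGroup.mk [(a, false)] = (FreeGroup.of a)⁻¹ := rfl
        simp only [hinv] at hsplit ⊢
        rw [map_inv, Equiv.Perm.inv_eq_iff_eq, hφ a _ (by simpa using h)]
        simp
      · have hof : FreeGroup.mk [(a, true)] = FreeGroup.of a := rfl
        simp only [hof] at hsplit ⊢
        exact hφ a _ (hsplit ▸ hm)
  obtain ⟨h, hw'⟩ := key w.toWord (List.suffix_refl _)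
  simp only [FreeGroup.mk_toWord, h1, Equiv.Perm.one_apply] at hw'
  exact hw (congrArg Subtype.val hw').symm

/-- Free groups of finite rank are Hopfian. -/
theorem injective_of_surjective_freeGroup {α : Type*} [Finite α] (f : FreeGroup α →* FreeGroup α)
    (hf : Function.Surjective f) : Function.Injective f := by
  rw [injective_iff_map_eq_one]
  intro w hw
  by_contra hne
  obtain ⟨S, _, φ, hφ⟩ := exists_finite_quotient_ne_one w hne
  -- Malcev's argument: precomposition with f is injective on this finite set, hence surjective, so
  -- φ factors through f and kills w.
  have : Finite (FreeGroup α →* Equiv.Perm S) := Finite.of_equiv _ FreeGroup.lift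
  have hinj : Function.Injective fun θ : FreeGroup α →* Equiv.Perm S => θ.comp f :=
    fun θ θ' h => MonoidHom.cancel_right hf |>.1 h
  obtain ⟨θ, hθ⟩ := Finite.surjective_of_injective hinj φ
  apply hφ
  rw [← hθ]
  simp [hw]

/-- A surjection induces an injection on homomorphisms to ℤ/2, of which a free group of rank r has
2^r. -/
theorem card_le_of_surjective_freeGroup {α β : Type*} [Fintype α] [Fintype β]
    (f : FreeGroup α →* FreeGroup β) (hf : Function.Surjective f) :
    Fintype.card β ≤ Fintype.card α := by
  classical
  have hinj : Function.Injective fun θ : FreeGroup β →* Multiplicative (ZMod 2) => θ.comp f :=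
    fun θ θ' h => MonoidHom.cancel_right hf |>.1 h
  have h2 := Fintype.card_le_of_injective (fun u : β → Multiplicative (ZMod 2) =>
      FreeGroup.lift.symm ((FreeGroup.lift u).comp f))
    (FreeGroup.lift.symm.injective.comp (hinj.comp FreeGroup.lift.injective))
  simp only [Fintype.card_fun, Fintype.card_multiplicative, ZMod.card] at h2
  exact (Nat.pow_le_pow_iff_right (by norm_num)).1 h2

end FreeGroups


/-! ### Construction of the homomorphisms f_I -/

section Standard

open scoped Pointwise

variable {n : ℕ}

/-- The automorphism `x ↦ x`, `y ↦ y⁻¹x⁻¹` of `F_2`. -/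
def twistX : MulAut (F 2) :=
  MonoidHom.toMulEquiv (FreeGroup.lift ![x, y⁻¹ * x⁻¹]) (FreeGroup.lift ![x, x⁻¹ * y⁻¹])
    (by ext i; fin_cases i <;> simp [x, y]) (by ext i; fin_cases i <;> simp [x, y])

/-- The automorphism `x ↦ y`, `y ↦ y⁻¹xy` of `F_2`. -/
def twistZ : MulAut (F 2) :=
  MonoidHom.toMulEquiv (FreeGroup.lift ![y, y⁻¹ * x * y]) (FreeGroup.lift ![x * y * x⁻¹, x])
    (by ext i; fin_cases i <;> simp [x, y, mul_assoc])
    (by ext i; fin_cases i <;> simp [x, y, mul_assoc])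

theorem twistX_x : twistX x = x := by
  show FreeGroup.lift ![x, y⁻¹ * x⁻¹] x = x
  simp [x]

theorem twistX_y : twistX y = y⁻¹ * x⁻¹ := by
  show FreeGroup.lift ![x, y⁻¹ * x⁻¹] y = _
  simp [y]

theorem twistZ_x : twistZ x = y := by
  show FreeGroup.lift ![y, y⁻¹ * x * y] x = y
  simp [x]

theorem twistZ_y : twistZ y = y⁻¹ * x * y := by
  show FreeGroup.lift ![y, y⁻¹ * x * y] y = _
  simp [y]

theorem mulAut_ext {φ ψ : MulAut (F 2)} (hx : φ x = ψ x) (hy : φ y = ψ y) : φ = ψ := by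
  have : φ.toMonoidHom = ψ.toMonoidHom := by
    ext i
    fin_cases i
    · exact hx
    · exact hy
  ext a
  exact DFunLike.congr_fun this a

/-- This gives an action of B_3 on F_2; by the two square formulas below it makes P_3 act by inner
automorphisms. -/
theorem twist_braid : twistX * twistZ * twistX = twistZ * twistX * twistZ := by
  apply mulAut_ext <;>
    simp [MulAut.mul_apply, twistX_x, twistX_y, twistZ_x, twistZ_y, mul_assoc]

theorem twistX_sq : twistX ^ 2 = MulAut.conj x := by
  apply mulAut_ext <;> simp [pow_two, MulAut.mul_apply, twistX_x, twistX_y, mul_assoc]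

theorem twistZ_sq : twistZ ^ 2 = MulAut.conj (y⁻¹ * x⁻¹) := by
  apply mulAut_ext <;> simp [pow_two, MulAut.mul_apply, twistZ_x, twistZ_y, mul_assoc]

/-- The automorphisms attached to a crossing, by the position of the crossing. -/
def twist (p : ℕ) : MulAut (F 2) := if Even p then twistX else twistZ

/-- Dependence on parity alone mirrors the surjection B_4 → B_3 that identifies the two outer
generators. -/
theorem twist_braid_succ (p : ℕ) :
    twist p * twist (p + 1) * twist p = twist (p + 1) * twist p * twist (p + 1) := by
  rcases Nat.even_or_odd p with h | h
  · simp [twist, h, Nat.even_add_one, twist_braid]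
  · simp [twist, Nat.even_add_one, Nat.not_even_iff_odd.2 h, twist_braid]

theorem twist_sq_mem (p : ℕ) : twist p ^ 2 ∈ (MulAut.conj (G := F 2)).range := by
  rw [twist]
  split_ifs
  · rw [twistX_sq]; exact ⟨_, rfl⟩
  · rw [twistZ_sq]; exact ⟨_, rfl⟩

theorem mem_adjSwap_smul (t : Fin (n - 1)) (I : Finset (Fin n)) (a : Fin n) :
    a ∈ adjSwap t • I ↔ adjSwap t a ∈ I := by
  rw [← Finset.inv_smul_mem_iff, adjSwap_inv, Equiv.Perm.smul_def]

/-- Two disjoint crossings within I use up all of I, so they occur at positions 0 and 2, where the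
attached automorphisms agree. Far commutation of the cocycle rests on this. -/
theorem even_countBelow {I : Finset (Fin n)} (hI : I.card ≤ 4) {a b c d : Fin n} (ha : a ∈ I)
    (hb : b ∈ I) (hc : c ∈ I) (hd : d ∈ I) (hab : a < b) (hbc : b < c) (hcd : c < d) :
    countBelow I a = 0 ∧ countBelow I c = 2 := by
  have hI' : ({a, b, c, d} : Finset (Fin n)) = I := by
    apply Finset.eq_of_subset_of_card_le
    · simp [Finset.insert_subset_iff, ha, hb, hc, hd]
    · rwa [Finset.card_insert_of_notMem, Finset.card_insert_of_notMem, Finset.card_pair hcd.ne] <;>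
        simp <;> omega
  have hac := hab.trans hbc
  have had := hac.trans hcd
  subst hI'
  simp [countBelow, Finset.filter_insert, Finset.filter_singleton, hbc, hcd.asymm, hac,
    hac.asymm, had.asymm, hab.asymm, hab.ne]

open Classical in
/-- The cocycle with values `twist p` at a crossing of two adjacent strands in `I`, where `p` strands
of `I` lie to the left. -/
def standardCocycle (n : ℕ) : BraidCocycle n (Finset (Fin n)) (MulAut (F 2)) where
  -- The bound 4 is needed: with five strands, disjoint crossings at positions 0 and 3 would require
  -- `twistX` and `twistZ` to commute. Larger I get the trivial cocycle.
  val t I := if I.card ≤ 4 ∧ (⟨t, by omega⟩ : Fin n) ∈ I ∧ (⟨t + 1, by omega⟩ : Fin n) ∈ I then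
    twist (countBelow I t) else 1
  braid := by
    rintro ⟨i, hi⟩ ⟨j, hj⟩ hij I
    obtain rfl : i + 1 = j := hij
    have count : ∀ J : Finset (Fin n), countBelow J (i + 1) =
        countBelow J i + if (⟨i, by omega⟩ : Fin n) ∈ J then 1 else 0 :=
      fun J => countBelow_succ J ⟨i, by omega⟩
    have e1 : i ≠ i + 1 + 1 := by omega
    have e2 : i + 1 + 1 ≠ i := by omega
    simp only [count, Finset.card_smul_finset, mem_adjSwap_smul,
      countBelow_adjSwap (n := n) _ ⟨i, hi⟩ (i := i) (by simp),
      countBelow_adjSwap (n := n) _ ⟨i + 1, hj⟩ (i := i) (by simp; omega)]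
    simp only [adjSwap, Equiv.swap_apply_def, Fin.mk.injEq]
    by_cases hA : (⟨i, by omega⟩ : Fin n) ∈ I <;>
    by_cases hB : (⟨i + 1, by omega⟩ : Fin n) ∈ I <;>
    by_cases hC : (⟨i + 1 + 1, by omega⟩ : Fin n) ∈ I <;>
    by_cases hI : I.card ≤ 4 <;>
    simp [hA, hB, hC, hI, twist_braid_succ, e1, e2]
  comm := by
    rintro ⟨i, hi⟩ ⟨j, hj⟩ hij I
    have hij : i + 2 ≤ j := hij
    simp only [Finset.card_smul_finset, mem_adjSwap_smul,
      countBelow_adjSwap (n := n) _ ⟨i, hi⟩ (i := j) (by simp; omega),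
      countBelow_adjSwap (n := n) _ ⟨j, hj⟩ (i := i) (by simp; omega)]
    simp only [adjSwap, Equiv.swap_apply_def, Fin.mk.injEq]
    simp only [show i ≠ j by omega, show i ≠ j + 1 by omega, show j ≠ i by omega,
      show j ≠ i + 1 by omega, show j + 1 ≠ i by omega, show i + 1 ≠ j by omega,
      add_left_inj, if_false]
    split_ifs with h1 h2 h2
    · have := even_countBelow h1.1 h2.2.1 h2.2.2 h1.2.1 h1.2.2 (Fin.mk_lt_mk.2 (by omega))
        (Fin.mk_lt_mk.2 (by omega)) (Fin.mk_lt_mk.2 (by omega))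
      rw [this.1, this.2]
      simp [twist]
    all_goals simp

/-- The value of the cocycle at `A_{r,s}`, in terms of the positions of `r` and `s` in `I`. -/
def bandValue (p : ℕ) : ℕ → MulAut (F 2)
  | 0 => 1
  | q + 1 => if p = q then twist p ^ 2 else twist q * bandValue p q * (twist q)⁻¹

theorem bandValue_mem (p q : ℕ) : bandValue p q ∈ (MulAut.conj (G := F 2)).range := by
  induction q with
  | zero => exact one_mem _
  | succ q ih =>
    rw [bandValue]
    split_ifs
    · exact twist_sq_mem p
    · obtain ⟨w, hw⟩ := ih
      rw [← hw]
      refine ⟨twist q w, ?_⟩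
      ext v
      simp [MulAut.mul_apply]

theorem countBelow_lt {I : Finset (Fin n)} {r s : ℕ} (hrs : r < s) (hr : r < n)
    (h : (⟨r, hr⟩ : Fin n) ∈ I) : countBelow I r < countBelow I s := by
  have h1 := countBelow_succ I ⟨r, hr⟩
  simp only [h, if_true] at h1
  have h2 : countBelow I (r + 1) ≤ countBelow I s :=
    Finset.card_le_card (Finset.monotone_filter_right _ fun a ha => by omega)
  omega

-- A crossing with a strand outside I contributes nothing, so each conjugation in the recursion for
-- `bd` either advances the position in I by one or leaves the value unchanged.
open Classical in
theorem standardCocycle_bd (I : Finset (Fin n)) {r s : ℕ} (hrs : r < s) (hs : s < n) :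
    (standardCocycle n).ext (bd n r s) I =
      if I.card ≤ 4 ∧ (⟨r, by omega⟩ : Fin n) ∈ I ∧ (⟨s, hs⟩ : Fin n) ∈ I then
        bandValue (countBelow I r) (countBelow I s) else 1 := by
  induction s, hrs using Nat.le_induction generalizing I with
  | base =>
    rw [BraidCocycle.ext_bd_self _ (by omega)]
    have h1 := countBelow_adjSwap I ⟨r, by omega⟩ (i := r) (by simp)
    have h2 := countBelow_succ I ⟨r, by omega⟩
    simp only [standardCocycle, h1, Finset.card_smul_finset, mem_adjSwap_smul]
    simp only [adjSwap, Equiv.swap_apply_left, Equiv.swap_apply_right]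
    by_cases hA : (⟨r, by omega⟩ : Fin n) ∈ I <;>
    by_cases hB : (⟨r + 1, by omega⟩ : Fin n) ∈ I <;>
    by_cases hI : I.card ≤ 4 <;>
    simp_all [bandValue, pow_two]
  | succ s hrs ih =>
    rw [BraidCocycle.ext_bd_succ _ hrs (by omega), ih _ (by omega)]
    have h1 := countBelow_adjSwap I ⟨s, by omega⟩ (i := r) (by simp; omega)
    have h2 := countBelow_adjSwap I ⟨s, by omega⟩ (i := s) (by simp)
    have h3 := countBelow_succ I ⟨s, by omega⟩
    have h4 : adjSwap (n := n) ⟨s, by omega⟩ ⟨r, by omega⟩ = ⟨r, by omega⟩ :=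
      Equiv.swap_apply_of_ne_of_ne (by simp; omega) (by simp; omega)
    have h5 := fun hr : (⟨r, by omega⟩ : Fin n) ∈ I => countBelow_lt hrs (by omega) hr
    simp only [standardCocycle, h1, h2, Finset.card_smul_finset, mem_adjSwap_smul, h4]
    simp only [adjSwap, Equiv.swap_apply_left, Equiv.swap_apply_right]
    by_cases hA : (⟨r, by omega⟩ : Fin n) ∈ I
    · have h6 := (h5 hA).ne
      by_cases hB : (⟨s, by omega⟩ : Fin n) ∈ I <;>
      by_cases hC : (⟨s + 1, by omega⟩ : Fin n) ∈ I <;>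
      by_cases hI : I.card ≤ 4 <;>
      simp_all [bandValue]
    · simp [hA]

/-- F_2 has trivial centre; this lets a cocycle with inner values on pure braids be read as a
homomorphism to F_2. -/
theorem conj_injective : Function.Injective (MulAut.conj (G := F 2)) := by
  rw [injective_iff_map_eq_one]
  intro w hw
  have h : ∀ v, Commute w v := fun v => by
    have := DFunLike.congr_fun hw v
    rw [MulAut.conj_apply, MulAut.one_apply, mul_inv_eq_iff_eq_mul] at this
    exact this
  exact eq_one_of_commute_of_commute (a := (0 : Fin 2)) (b := 1) (by decide) (h _) (h _)

theorem standardCocycle_mem (I : Finset (Fin n)) (a : PureBraidGroup n) :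
    (standardCocycle n).pure I a ∈ (MulAut.conj (G := F 2)).range := by
  have h : Subgroup.closure {a : PureBraidGroup n | ∃ r s h, a = A r s h} ≤
      (MulAut.conj (G := F 2)).range.comap ((standardCocycle n).pure I) := by
    rw [Subgroup.closure_le]
    rintro _ ⟨r, s, h, rfl⟩
    show (standardCocycle n).ext (A r s h : BraidGroup n) I ∈ (MulAut.conj (G := F 2)).range
    rw [coe_A, standardCocycle_bd I h s.2]
    split_ifs
    · exact bandValue_mem _ _
    · exact one_mem _
  rw [closure_A] at h
  exact h trivial

/-- The homomorphism `f_I`. -/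
noncomputable def standardHom (I : Finset (Fin n)) : PureBraidGroup n →* F 2 :=
  (MonoidHom.ofInjective conj_injective).symm.toMonoidHom.comp
    (((standardCocycle n).pure I).codRestrict _ (standardCocycle_mem I))

theorem conj_standardHom (I : Finset (Fin n)) (a : PureBraidGroup n) :
    MulAut.conj (standardHom I a) = (standardCocycle n).ext a I := by
  have := (MonoidHom.ofInjective conj_injective).apply_symm_apply
    (((standardCocycle n).pure I).codRestrict _ (standardCocycle_mem I) a)
  exact congrArg Subtype.val this

/-- Conjugation by a braid permutes the homomorphisms `f_I` up to automorphisms of `F_2`. -/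
theorem standardHom_conj (I : Finset (Fin n)) (β : BraidGroup n) :
    ∃ ψ : MulAut (F 2), ∀ a : PureBraidGroup n,
      standardHom I (MulAut.conjNormal β a) = ψ (standardHom ((toPerm n β)⁻¹ • I) a) := by
  refine ⟨(standardCocycle n).ext β ((toPerm n β)⁻¹ • I), fun a => conj_injective ?_⟩
  rw [conj_standardHom, MulAut.conjNormal_apply,
    BraidCocycle.ext_conj _ _ _ (MonoidHom.mem_ker.1 a.2), ← conj_standardHom]
  ext v
  simp [MulAut.mul_apply]

end Standard

/-! ### Values of f_I on the generators, uniqueness and surjectivity -/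

section Standard

open scoped Pointwise

variable {n : ℕ}

theorem standardHom_A_eq {I : Finset (Fin n)} {r s : Fin n} (h : r < s) (hI : I.card ≤ 4)
    (hr : r ∈ I) (hs : s ∈ I) {w : F 2}
    (hw : bandValue (countBelow I r) (countBelow I s) = MulAut.conj w) :
    standardHom I (A r s h) = w := by
  apply conj_injective
  rw [conj_standardHom, coe_A, standardCocycle_bd I h s.2, if_pos ⟨hI, hr, hs⟩, hw]

theorem standardHom_A_eq_one {I : Finset (Fin n)} {r s : Fin n} (h : r < s)
    (hI : ¬(r ∈ I ∧ s ∈ I)) : standardHom I (A r s h) = 1 := by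
  apply conj_injective
  rw [conj_standardHom, coe_A, standardCocycle_bd I h s.2, if_neg (fun h => hI h.2), map_one]

theorem mulAut_mul_conj_mul_inv (φ : MulAut (F 2)) (w : F 2) :
    φ * MulAut.conj w * φ⁻¹ = MulAut.conj (φ w) := by
  ext v
  simp [MulAut.mul_apply]

theorem bandValue_zero_one : bandValue 0 1 = MulAut.conj x := by
  simp [bandValue, twist, twistX_sq]

theorem bandValue_one_two : bandValue 1 2 = MulAut.conj (y⁻¹ * x⁻¹) := by
  simp [bandValue, twist, twistZ_sq]

theorem bandValue_two_three : bandValue 2 3 = MulAut.conj x := by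
  simp [bandValue, twist, twistX_sq]

theorem bandValue_zero_two : bandValue 0 2 = MulAut.conj y := by
  rw [bandValue, bandValue_zero_one, mulAut_mul_conj_mul_inv]
  simp [twist, twistZ_x]

theorem bandValue_one_three : bandValue 1 3 = MulAut.conj (x * y * x⁻¹) := by
  rw [bandValue, bandValue_one_two, mulAut_mul_conj_mul_inv]
  simp [twist, twistX_x, twistX_y]

theorem bandValue_zero_three : bandValue 0 3 = MulAut.conj (y⁻¹ * x⁻¹) := by
  rw [bandValue, bandValue_zero_two, mulAut_mul_conj_mul_inv]
  simp [twist, twistX_y]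

theorem standardHom_value₃ {i j k : Fin n} (hij : i < j) (hjk : j < k) {r s : Fin n} (h : r < s) :
    standardHom {i, j, k} (A r s h) = value₃ i j k r s := by
  have hik := hij.trans hjk
  have hc : ({i, j, k} : Finset (Fin n)).card ≤ 4 := Finset.card_le_three.trans (by norm_num)
  have ci : countBelow {i, j, k} i = 0 := by
    simp [countBelow, Finset.filter_insert, Finset.filter_singleton, hij.asymm, hik.asymm]
  have cj : countBelow {i, j, k} j = 1 := by
    simp [countBelow, Finset.filter_insert, Finset.filter_singleton, hij, hjk.asymm]
  have ck : countBelow {i, j, k} k = 2 := by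
    simp [countBelow, Finset.filter_insert, Finset.filter_singleton, hij.ne, hjk, hik]
  by_cases hrs : r ∈ ({i, j, k} : Finset (Fin n)) ∧ s ∈ ({i, j, k} : Finset (Fin n))
  · refine standardHom_A_eq h hc hrs.1 hrs.2 ?_
    obtain ⟨hr, hs⟩ := hrs
    simp only [Finset.mem_insert, Finset.mem_singleton] at hr hs
    rcases hr with rfl | rfl | rfl <;> rcases hs with rfl | rfl | rfl <;>
      first
      | (exfalso; order)
      | simp [ci, cj, ck, value₃, bandValue_zero_one, bandValue_one_two, bandValue_zero_two,
          hij.ne', hjk.ne']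
  · rw [standardHom_A_eq_one h hrs]
    simp only [Finset.mem_insert, Finset.mem_singleton] at hrs
    rw [value₃, if_neg (by tauto), if_neg (by tauto), if_neg (by tauto)]

theorem standardHom_value₄ {i j k l : Fin n} (hij : i < j) (hjk : j < k) (hkl : k < l)
    {r s : Fin n} (h : r < s) :
    standardHom {i, j, k, l} (A r s h) = value₄ i j k l r s := by
  have hik := hij.trans hjk
  have hil := hik.trans hkl
  have hjl := hjk.trans hkl
  have hc : ({i, j, k, l} : Finset (Fin n)).card ≤ 4 := Finset.card_le_four
  have ci : countBelow {i, j, k, l} i = 0 := by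
    simp [countBelow, Finset.filter_insert, Finset.filter_singleton, hij.asymm, hik.asymm,
      hil.asymm]
  have cj : countBelow {i, j, k, l} j = 1 := by
    simp [countBelow, Finset.filter_insert, Finset.filter_singleton, hij, hjk.asymm, hjl.asymm]
  have ck : countBelow {i, j, k, l} k = 2 := by
    simp [countBelow, Finset.filter_insert, Finset.filter_singleton, hij.ne, hjk, hik, hkl.asymm]
  have cl : countBelow {i, j, k, l} l = 3 := by
    simp [countBelow, Finset.filter_insert, Finset.filter_singleton, hij.ne, hjk.ne, hik.ne, hil,
      hjl, hkl]
  by_cases hrs : r ∈ ({i, j, k, l} : Finset (Fin n)) ∧ s ∈ ({i, j, k, l} : Finset (Fin n))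
  · refine standardHom_A_eq h hc hrs.1 hrs.2 ?_
    obtain ⟨hr, hs⟩ := hrs
    simp only [Finset.mem_insert, Finset.mem_singleton] at hr hs
    rcases hr with rfl | rfl | rfl | rfl <;> rcases hs with rfl | rfl | rfl | rfl <;>
      first
      | (exfalso; order)
      | simp [ci, cj, ck, cl, value₄, bandValue_zero_one, bandValue_one_two, bandValue_zero_two,
          bandValue_zero_three, bandValue_one_three, bandValue_two_three, hij.ne', hjk.ne', hik.ne',
          hjl.ne', hkl.ne']
  · rw [standardHom_A_eq_one h hrs]
    simp only [Finset.mem_insert, Finset.mem_singleton] at hrs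
    rw [value₄, if_neg (by tauto), if_neg (by tauto), if_neg (by tauto), if_neg (by tauto),
      if_neg (by tauto), if_neg (by tauto)]

theorem isStandard_standardHom {I : Finset (Fin n)} (hI : I.card = 3 ∨ I.card = 4) :
    IsStandard I (standardHom I) := by
  rcases hI with hI | hI
  · let e := I.orderEmbOfFin hI
    have hI' : I = {e 0, e 1, e 2} := by
      ext a
      rw [← Finset.mem_coe, ← Finset.range_orderEmbOfFin I hI, Set.mem_range]
      simp only [Finset.mem_insert, Finset.mem_singleton]
      constructor
      · rintro ⟨t, rfl⟩
        fin_cases t <;> simp [e]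
      · rintro (rfl | rfl | rfl) <;> exact ⟨_, rfl⟩
    refine Or.inl ⟨e 0, e 1, e 2, e.strictMono (by decide), e.strictMono (by decide), hI',
      fun r s h => ?_⟩
    rw [hI']
    exact standardHom_value₃ (e.strictMono (by decide)) (e.strictMono (by decide)) h
  · let e := I.orderEmbOfFin hI
    have hI' : I = {e 0, e 1, e 2, e 3} := by
      ext a
      rw [← Finset.mem_coe, ← Finset.range_orderEmbOfFin I hI, Set.mem_range]
      simp only [Finset.mem_insert, Finset.mem_singleton]
      constructor
      · rintro ⟨t, rfl⟩
        fin_cases t <;> simp [e]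
      · rintro (rfl | rfl | rfl | rfl) <;> exact ⟨_, rfl⟩
    refine Or.inr ⟨e 0, e 1, e 2, e 3, e.strictMono (by decide), e.strictMono (by decide),
      e.strictMono (by decide), hI', fun r s h => ?_⟩
    rw [hI']
    exact standardHom_value₄ (e.strictMono (by decide)) (e.strictMono (by decide))
      (e.strictMono (by decide)) h

theorem IsStandard.eq_standardHom {I : Finset (Fin n)} {f : PureBraidGroup n →* F 2}
    (hf : IsStandard I f) : f = standardHom I := by
  rcases hf with ⟨i, j, k, hij, hjk, rfl, h⟩ | ⟨i, j, k, l, hij, hjk, hkl, rfl, h⟩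
  · exact hom_ext_A fun r s hrs => (h r s hrs).trans (standardHom_value₃ hij hjk hrs).symm
  · exact hom_ext_A fun r s hrs => (h r s hrs).trans (standardHom_value₄ hij hjk hkl hrs).symm

theorem surjective_of_mem_range {G : Type*} [Group G] {f : G →* F 2} (hx : x ∈ f.range)
    (hy : y ∈ f.range) : Function.Surjective f := by
  rw [← MonoidHom.range_eq_top, eq_top_iff, ← FreeGroup.closure_range_of, Subgroup.closure_le]
  rintro _ ⟨i, rfl⟩
  fin_cases i
  · exact hx
  · exact hy

theorem IsStandard.surjective {I : Finset (Fin n)} {f : PureBraidGroup n →* F 2}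
    (hf : IsStandard I f) : Function.Surjective f := by
  rcases hf with ⟨i, j, k, hij, hjk, -, h⟩ | ⟨i, j, k, l, hij, hjk, hkl, -, h⟩
  · exact surjective_of_mem_range ⟨_, (h i j hij).trans (by simp [value₃])⟩
      ⟨_, (h i k (hij.trans hjk)).trans (by simp [value₃, hjk.ne'])⟩
  · exact surjective_of_mem_range ⟨_, (h i j hij).trans (by simp [value₄])⟩
      ⟨_, (h i k (hij.trans hjk)).trans (by simp [value₄, hjk.ne'])⟩

end Standard

/-! ### Homomorphisms from P_n to free groups with nonabelian image -/

section Classification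

open scoped Pointwise

variable {n : ℕ}

theorem A_triple {i j k : Fin n} (hij : i < j) (hjk : j < k) :
    Commute (A i j hij) (A i k (hij.trans hjk) * A j k hjk) ∧
      Commute (A j k hjk) (A i j hij * A i k (hij.trans hjk)) := by
  obtain ⟨h1, h2⟩ := bd_triple (n := n) hij hjk k.2
  exact ⟨Subtype.ext (by simpa [coe_A] using h1.eq), Subtype.ext (by simpa [coe_A] using h2.eq)⟩

theorem A_commute_of_lt {r s t u : Fin n} (hrs : r < s) (hst : s < t) (htu : t < u) :
    Commute (A r s hrs) (A t u htu) :=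
  Subtype.ext (by simpa [coe_A] using (bd_commute_of_lt (n := n) hrs hst htu).eq)

theorem A_commute_of_nested {r s t u : Fin n} (hrt : r < t) (htu : t < u) (hus : u < s) :
    Commute (A r s (hrt.trans (htu.trans hus))) (A t u htu) :=
  Subtype.ext (by simpa [coe_A] using (bd_commute_of_nested (n := n) hrt htu hus s.2).eq)

theorem A_commute_of_interlaced {i j k l : Fin n} (hij : i < j) (hjk : j < k) (hkl : k < l) :
    Commute (A i k (hij.trans hjk)) ((A k l hkl)⁻¹ * A j l (hjk.trans hkl) * A k l hkl) :=
  Subtype.ext (by simpa [coe_A] using (bd_commute_of_interlaced (n := n) hij hjk hkl l.2).eq)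

variable {G : Type*} [Group G]

/-- If `f` has nonabelian image, then the images of the generators for some triple of strands do
not commute. -/
theorem exists_not_commute_triple (f : PureBraidGroup n →* G)
    (hf : ∃ a b, ¬Commute (f a) (f b)) :
    ∃ (i j k : Fin n) (hij : i < j) (hjk : j < k),
      ¬(Commute (f (A i j hij)) (f (A i k (hij.trans hjk))) ∧
        Commute (f (A i j hij)) (f (A j k hjk)) ∧
        Commute (f (A i k (hij.trans hjk))) (f (A j k hjk))) := by
  by_contra! hcon
  obtain ⟨a, b, hab⟩ := hf
  have gen' : ∀ r s t u (hrs : r < s) (htu : t < u), r ≤ t →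
      Commute (f (A r s hrs)) (f (A t u htu)) := by
    intro r s t u hrs htu hrt
    rcases hrt.eq_or_lt with rfl | hrt
    · rcases lt_trichotomy s u with h | rfl | h
      · exact (hcon r s u hrs h).1
      · exact Commute.refl _
      · exact (hcon r u s htu h).1.symm
    · rcases lt_trichotomy s t with h | rfl | h
      · exact (A_commute_of_lt hrs h htu).map f
      · exact (hcon r s u hrs htu).2.1
      · rcases lt_trichotomy s u with h' | rfl | h'
        -- In the interlaced relation the conjugating factor drops out, because the images for the
        -- triple t, s, u commute.
        · have h1 := (A_commute_of_interlaced hrt h h').map f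
          rw [map_mul, map_mul, map_inv, mul_assoc, (hcon t s u h h').2.2.eq,
            inv_mul_cancel_left] at h1
          exact h1
        · exact (hcon r t s hrt htu).2.2
        · exact (A_commute_of_nested hrt htu h').map f
  have gen : ∀ r s t u (hrs : r < s) (htu : t < u), Commute (f (A r s hrs)) (f (A t u htu)) := by
    intro r s t u hrs htu
    rcases le_total r t with h | h
    · exact gen' _ _ _ _ hrs htu h
    · exact (gen' _ _ _ _ htu hrs h).symm
  have key : ∀ (g : G), (∀ r s hrs, Commute g (f (A r s hrs))) → ∀ b, Commute g (f b) := by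
    intro g hg b
    have : Subgroup.closure {a : PureBraidGroup n | ∃ r s h, a = A r s h} ≤
        (Subgroup.centralizer {g}).comap f := by
      rw [Subgroup.closure_le]
      rintro _ ⟨r, s, h, rfl⟩
      exact Subgroup.mem_centralizer_singleton_iff.2 (hg r s h).symm.eq
    rw [closure_A] at this
    exact (Subgroup.mem_centralizer_singleton_iff.1 (this (Subgroup.mem_top b))).symm
  exact hab (key _ (fun r s hrs => (key _ (fun t u htu => gen r s t u hrs htu) a).symm) b)

variable [IsFreeGroup G]

/-- The product commutes with all three factors, so if it were nontrivial they would commute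
pairwise. Once it is 1, any two factors determine the third, and one commuting pair would make all
of them commute. -/
theorem triple_of_not_commute {a b c : G} (h1 : Commute a (b * c)) (h2 : Commute c (a * b))
    (h : ¬(Commute a b ∧ Commute a c ∧ Commute b c)) :
    a * b * c = 1 ∧ ¬Commute a b ∧ ¬Commute a c ∧ ¬Commute b c := by
  have ha : Commute a (a * b * c) := by rw [mul_assoc]; exact (Commute.refl a).mul_right h1
  have hc : Commute c (a * b * c) := h2.mul_right (Commute.refl c)
  have hb : Commute b (a * b * c) := by
    have : b = a⁻¹ * (a * b * c) * c⁻¹ := by group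
    conv_lhs => rw [this]
    exact (ha.inv_left.mul_left (Commute.refl _)).mul_left hc.inv_left
  have hz : a * b * c = 1 := by
    by_contra hz
    exact h ⟨commute_trans_of_isFreeGroup hz ha hb.symm, commute_trans_of_isFreeGroup hz ha hc.symm,
      commute_trans_of_isFreeGroup hz hb hc.symm⟩
  have hc' : c = b⁻¹ * a⁻¹ := by rw [← mul_inv_rev]; exact eq_inv_of_mul_eq_one_right hz
  have hb' : b = a⁻¹ * c⁻¹ := by rw [hc']; group
  have ha' : a = c⁻¹ * b⁻¹ := by rw [hc']; group
  refine ⟨hz, fun hab => h ⟨hab, ?_, ?_⟩, fun hac => h ⟨?_, hac, ?_⟩, fun hbc => h ⟨?_, ?_, hbc⟩⟩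
  · rw [hc']; exact hab.inv_right.mul_right (Commute.refl a).inv_right
  · rw [hc']; exact (Commute.refl b).inv_right.mul_right hab.symm.inv_right
  · rw [hb']; exact (Commute.refl a).inv_right.mul_right hac.inv_right
  · rw [hb']; exact hac.inv_left.mul_left (Commute.refl c).inv_left
  · rw [ha']; exact hbc.symm.inv_left.mul_left (Commute.refl b).inv_left
  · rw [ha']; exact (Commute.refl c).inv_left.mul_left hbc.inv_left

theorem eq_one_of_commute_of_not_commute {a b c : G} (hab : Commute a b) (hac : Commute a c)
    (h : ¬Commute b c) : a = 1 := by
  by_contra ha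
  exact h (commute_trans_of_isFreeGroup ha hab.symm hac)

/-- The values on the generators when the triple `0, 1, 2` is noncommuting. -/
theorem solve_fourth_strand {a b c p q r : G} (habc : a * b * c = 1) (hac : ¬Commute a c)
    (h1 : a * p * q = 1) (h3 : c * q * r = 1) (hpc : Commute p c)
    (hra : Commute r a) : p = c ∧ q = a * b * a⁻¹ ∧ r = a := by
  have hq : q = p⁻¹ * a⁻¹ := by rw [← mul_inv_rev]; exact eq_inv_of_mul_eq_one_right h1
  -- The left side commutes with c and the right side with a; as a and c do not commute, both sides
  -- are trivial.
  have he : p * c⁻¹ = a⁻¹ * r := by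
    have : r = (c * q)⁻¹ := eq_inv_of_mul_eq_one_right h3
    rw [this, hq, mul_inv_rev, mul_inv_rev, inv_inv, inv_inv]; group
  have h4 : p * c⁻¹ = 1 := by
    refine eq_one_of_commute_of_not_commute (b := a) (c := c) ?_ ?_ hac
    · rw [he]; exact (Commute.refl a).inv_left.mul_left hra
    · exact hpc.mul_left (Commute.refl c).inv_left
  have hp : p = c := mul_inv_eq_one.1 h4
  have hr : r = a := (inv_mul_eq_one.1 (he.symm.trans h4)).symm
  have hc : c = b⁻¹ * a⁻¹ := by rw [← mul_inv_rev]; exact eq_inv_of_mul_eq_one_right habc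
  exact ⟨hp, by rw [hq, hp, hc]; group, hr⟩

/-- The noncommuting triple fixes everything: bands beyond it commute with two noncommuting elements
and vanish, and each later strand is invisible or solved for. I consists of 0, 1, 2 and the visible
later strand, if any; the factor map sends x and y to the images of `A_{0,1}` and `A_{0,2}`. -/
theorem exists_eq_comp_standardHom_of_zero_one_two (hn : 3 ≤ n) (f : PureBraidGroup n →* G)
    (hf : ¬(Commute (f (A ⟨0, by omega⟩ ⟨1, by omega⟩ (by simp)))
          (f (A ⟨0, by omega⟩ ⟨2, by omega⟩ (by simp))) ∧
        Commute (f (A ⟨0, by omega⟩ ⟨1, by omega⟩ (by simp)))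
          (f (A ⟨1, by omega⟩ ⟨2, by omega⟩ (by simp))) ∧
        Commute (f (A ⟨0, by omega⟩ ⟨2, by omega⟩ (by simp)))
          (f (A ⟨1, by omega⟩ ⟨2, by omega⟩ (by simp))))) :
    ∃ (I : Finset (Fin n)) (g : F 2 →* G), (I.card = 3 ∨ I.card = 4) ∧
      f = g.comp (standardHom I) := by
  obtain ⟨i, hi⟩ : ∃ i : Fin n, i = ⟨0, by omega⟩ := ⟨_, rfl⟩
  obtain ⟨j, hj⟩ : ∃ j : Fin n, j = ⟨1, by omega⟩ := ⟨_, rfl⟩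
  obtain ⟨k, hk⟩ : ∃ k : Fin n, k = ⟨2, by omega⟩ := ⟨_, rfl⟩
  simp only [← hi, ← hj, ← hk] at hf
  have hij : i < j := by rw [hi, hj]; simp
  have hjk : j < k := by rw [hj, hk]; simp
  have hik := hij.trans hjk
  have cases_lt : ∀ r : Fin n, r = i ∨ r = j ∨ r = k ∨ k < r := by
    intro r
    simp only [hi, hj, hk, Fin.ext_iff, Fin.lt_def]
    omega
  have lt_of_ne : ∀ r s : Fin n, r < s → ¬(r = i ∧ s = j) → ¬(r = i ∧ s = k) →
      ¬(r = j ∧ s = k) → k < s := by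
    intro r s
    simp only [hi, hj, hk, Fin.ext_iff, Fin.lt_def]
    omega
  let a : Fin n → Fin n → G := fun r s => if h : r < s then f (A r s h) else 1
  have ha : ∀ {r s} (h : r < s), f (A r s h) = a r s := fun {r s} h => by
    show _ = dite _ _ _
    rw [dif_pos h]
  have tri : ∀ {r s t}, r < s → s < t →
      ¬(Commute (a r s) (a r t) ∧ Commute (a r s) (a s t) ∧ Commute (a r t) (a s t)) →
      a r s * a r t * a s t = 1 ∧ ¬Commute (a r s) (a r t) ∧ ¬Commute (a r s) (a s t) ∧
        ¬Commute (a r t) (a s t) := by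
    intro r s t hrs hst h
    have := A_triple hrs hst
    refine triple_of_not_commute ?_ ?_ h
    · simpa [ha] using this.1.map f
    · simpa [ha] using this.2.map f
  have lt : ∀ {r s t u}, r < s → s < t → t < u → Commute (a r s) (a t u) :=
    fun hrs hst htu => by simpa [ha] using (A_commute_of_lt hrs hst htu).map f
  have nest : ∀ {r s t u}, r < t → t < u → u < s → Commute (a r s) (a t u) :=
    fun hrt htu hus => by simpa [ha] using (A_commute_of_nested hrt htu hus).map f
  simp only [ha] at hf
  obtain ⟨hz, hxy, hxz, hyz⟩ := tri hij hjk hf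
  have far : ∀ {r s}, k < r → r < s → a r s = 1 := fun hkr hrs =>
    eq_one_of_commute_of_not_commute (lt hij (hjk.trans hkr) hrs).symm
      (lt hik hkr hrs).symm hxy
  -- The split is on `a i l`. If it is trivial, no triple containing i and l can be noncommuting,
  -- and the rest vanishes. If not, the triples formed by l with two of i, j, k are all noncommuting
  -- and have product 1.
  have alt : ∀ l, k < l → (a i l = 1 ∧ a j l = 1 ∧ a k l = 1) ∨
      (a i l = a j k ∧ a j l = a i j * a i k * (a i j)⁻¹ ∧ a k l = a i j) := by
    intro l hkl
    have hjl := hjk.trans hkl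
    have hil := hij.trans hjl
    have c1 : Commute (a i l) (a j k) := nest hij hjk hkl
    have c2 : Commute (a i j) (a k l) := lt hij hjk hkl
    by_cases h0 : a i l = 1
    · left
      have h1 : Commute (a i j) (a j l) := by
        by_contra h
        exact (tri hij hjl (fun h' => h h'.2.1)).2.1 (h0 ▸ Commute.one_right _)
      have h2 : Commute (a i k) (a k l) := by
        by_contra h
        exact (tri hik hkl (fun h' => h h'.2.1)).2.1 (h0 ▸ Commute.one_right _)
      have h3 := eq_one_of_commute_of_not_commute c2.symm h2.symm hxy
      have h4 : Commute (a j k) (a j l) := by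
        by_contra h
        exact (tri hjk hkl (fun h' => h h'.1)).2.2.1 (h3 ▸ Commute.one_right _)
      exact ⟨h0, eq_one_of_commute_of_not_commute h1.symm h4.symm hxz, h3⟩
    · right
      have h1 : ¬Commute (a i j) (a i l) := fun h =>
        h0 (eq_one_of_commute_of_not_commute h.symm c1 hxz)
      have h2 : ¬Commute (a i k) (a i l) := fun h =>
        h0 (eq_one_of_commute_of_not_commute h.symm c1 hyz)
      have t1 := (tri hij hjl (fun h => h1 h.1)).1
      have t2 := tri hik hkl (fun h => h2 h.1)
      have h3 : ¬Commute (a j k) (a k l) := fun h =>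
        t2.2.2.1 ((eq_one_of_commute_of_not_commute c2.symm h.symm hxz) ▸ Commute.one_right _)
      have t3 := (tri hjk hkl (fun h => h3 h.2.1)).1
      exact solve_fourth_strand hz hxz t1 t3 c1 c2.symm
  by_cases hl : ∃ l, k < l ∧ a i l ≠ 1
  · obtain ⟨l, hkl, hl⟩ := hl
    have hal := (alt l hkl).resolve_left fun h => hl h.1
    -- With two visible strands, the nested bands from i to the larger one and from k to the smaller
    -- one would have commuting images `a j k` and `a i j`.
    have other : ∀ m, k < m → m ≠ l → a i m = 1 ∧ a j m = 1 ∧ a k m = 1 := by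
      intro m hkm hml
      refine (alt m hkm).resolve_right fun ham => hxz ?_
      rcases lt_or_gt_of_ne hml with h | h
      · have := nest hik hkm h
        rw [ham.2.2, hal.1] at this
        exact this.symm
      · have := nest hik hkl h
        rw [hal.2.2, ham.1] at this
        exact this.symm
    refine ⟨{i, j, k, l}, FreeGroup.lift ![a i j, a i k], Or.inr ?_, hom_ext_A fun r s hrs => ?_⟩
    · have hjl := hjk.trans hkl
      simp [hij.ne, hik.ne, (hij.trans hjl).ne, hjk.ne, hjl.ne, hkl.ne]
    · rw [MonoidHom.comp_apply, standardHom_value₄ hij hjk hkl, ha]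
      have hz' : a j k = (a i k)⁻¹ * (a i j)⁻¹ := by
        rw [← mul_inv_rev]; exact eq_inv_of_mul_eq_one_right hz
      rw [value₄]
      split_ifs with h1 h2 h3 h4 h5 h6
      · simp [h1.1, h1.2, x]
      · simp [h2.1, h2.2, y]
      · simp [h3.1, h3.2, x, y, hz']
      · simp [h4.1, h4.2, x, y, hal.1, hz']
      · simp [h5.1, h5.2, x, y, hal.2.1]
      · simp [h6.1, h6.2, x, hal.2.2]
      · rw [map_one]
        have hs := lt_of_ne r s hrs h1 h2 h3
        rcases cases_lt r with rfl | rfl | rfl | hr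
        · exact (other s hs fun h => h4 ⟨rfl, h⟩).1
        · exact (other s hs fun h => h5 ⟨rfl, h⟩).2.1
        · exact (other s hs fun h => h6 ⟨rfl, h⟩).2.2
        · exact far hr hrs
  · push Not at hl
    refine ⟨{i, j, k}, FreeGroup.lift ![a i j, a i k], Or.inl ?_, hom_ext_A fun r s hrs => ?_⟩
    · simp [hij.ne, hik.ne, hjk.ne]
    · rw [MonoidHom.comp_apply, standardHom_value₃ hij hjk, ha]
      have triv : ∀ l, k < l → a i l = 1 ∧ a j l = 1 ∧ a k l = 1 := fun l hkl =>
        (alt l hkl).resolve_right fun h => hyz (by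
          rw [← h.1, hl l hkl]; exact Commute.one_right _)
      have hz' : a j k = (a i k)⁻¹ * (a i j)⁻¹ := by
        rw [← mul_inv_rev]; exact eq_inv_of_mul_eq_one_right hz
      rw [value₃]
      split_ifs with h1 h2 h3
      · simp [h1.1, h1.2, x]
      · simp [h2.1, h2.2, y]
      · simp [h3.1, h3.2, x, y, hz']
      · rw [map_one]
        have hs := lt_of_ne r s hrs h1 h2 h3
        rcases cases_lt r with rfl | rfl | rfl | hr
        · exact (triv s hs).1
        · exact (triv s hs).2.1
        · exact (triv s hs).2.2
        · exact far hr hrs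

/-- Every homomorphism from a pure braid group to a free group with nonabelian image factors through
one of the homomorphisms `f_I`. -/
theorem exists_eq_comp_standardHom (hn : 3 ≤ n) (f : PureBraidGroup n →* G)
    (hf : ∃ a b, ¬Commute (f a) (f b)) :
    ∃ (I : Finset (Fin n)) (g : F 2 →* G), (I.card = 3 ∨ I.card = 4) ∧
      f = g.comp (standardHom I) := by
  obtain ⟨i, j, k, hij, hjk, hijk⟩ := exists_not_commute_triple f hf
  obtain ⟨β, h1, h2, h3⟩ := exists_semiconjBy_bd (n := n) hij hjk k.2
  have conj : ∀ {r s t u : Fin n} (hrs : r < s) (htu : t < u),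
      SemiconjBy β (bd n r s) (bd n t u) → MulAut.conjNormal β (A r s hrs) = A t u htu := by
    intro r s t u hrs htu h
    apply Subtype.ext
    rw [MulAut.conjNormal_apply, coe_A, coe_A, h.eq, mul_inv_cancel_right]
  obtain ⟨I, g, hI, hfg⟩ := exists_eq_comp_standardHom_of_zero_one_two hn
    (f.comp (MulAut.conjNormal β).toMonoidHom) (by
      have e1 := conj (r := ⟨0, by omega⟩) (s := ⟨1, by omega⟩) (by simp) hij h1
      have e2 := conj (r := ⟨0, by omega⟩) (s := ⟨2, by omega⟩) (by simp) (hij.trans hjk) h2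
      have e3 := conj (r := ⟨1, by omega⟩) (s := ⟨2, by omega⟩) (by simp) hjk h3
      rw [← e1, ← e2, ← e3] at hijk
      exact hijk)
  -- Undoing the conjugation by β permutes I and changes f_I by an automorphism of F_2, which is
  -- absorbed into g.
  obtain ⟨ψ, hψ⟩ := standardHom_conj I β⁻¹
  refine ⟨(toPerm n β⁻¹)⁻¹ • I, g.comp ψ.toMonoidHom, by simpa using hI, ?_⟩
  ext a
  have := DFunLike.congr_fun hfg (MulAut.conjNormal β⁻¹ a)
  rw [MonoidHom.comp_apply, MonoidHom.comp_apply, hψ] at this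
  refine Eq.trans ?_ this
  show f a = f (MulAut.conjNormal β (MulAut.conjNormal β⁻¹ a))
  rw [map_inv, MulAut.apply_inv_self]

end Classification

/-! ### Artin's representation and its faithfulness on pure braids -/

section Artin

variable {n : ℕ}

/-- The free generator with index `i`, and `1` if there is none. -/
def gen (n i : ℕ) : FreeGroup (Fin n) := if h : i < n then FreeGroup.of ⟨i, h⟩ else 1

theorem of_eq_gen (i : Fin n) : FreeGroup.of i = gen n i := by
  rw [gen, dif_pos i.2]

theorem gen_of_lt {i : ℕ} (h : i < n) : gen n i = FreeGroup.of ⟨i, h⟩ := dif_pos h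

/-- The endomorphism with given values on the generators. -/
def endo (n : ℕ) (v : ℕ → FreeGroup (Fin n)) : FreeGroup (Fin n) →* FreeGroup (Fin n) :=
  FreeGroup.lift fun i => v i

theorem endo_gen (v : ℕ → FreeGroup (Fin n)) {i : ℕ} (h : i < n) : endo n v (gen n i) = v i := by
  rw [gen_of_lt h, endo, FreeGroup.lift_apply_of]

theorem endo_ext {H : Type*} [Group H] {f g : FreeGroup (Fin n) →* H}
    (h : ∀ i < n, f (gen n i) = g (gen n i)) : f = g := by
  ext i
  rw [of_eq_gen]
  exact h i i.2

theorem mulAut_gen_ext {f g : MulAut (FreeGroup (Fin n))}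
    (h : ∀ i < n, f (gen n i) = g (gen n i)) : f = g := by
  have : f.toMonoidHom = g.toMonoidHom := endo_ext h
  ext a
  exact DFunLike.congr_fun this a

/-- The values of the automorphism of a free group attached to an Artin generator. -/
def artinVal (n t : ℕ) (i : ℕ) : FreeGroup (Fin n) :=
  if i = t then gen n (t + 1)
  else if i = t + 1 then (gen n (t + 1))⁻¹ * gen n t * gen n (t + 1) else gen n i

/-- The values of the inverse of that automorphism. -/
def artinInvVal (n t : ℕ) (i : ℕ) : FreeGroup (Fin n) :=
  if i = t then gen n t * gen n (t + 1) * (gen n t)⁻¹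
  else if i = t + 1 then gen n t else gen n i

/-- The automorphism of a free group attached to an Artin generator. -/
def artinGen (t : Fin (n - 1)) : MulAut (FreeGroup (Fin n)) :=
  MonoidHom.toMulEquiv (endo n (artinVal n t)) (endo n (artinInvVal n t))
    (endo_ext fun i hi => by
      have h1 : (t : ℕ) < n := by omega
      have h2 : (t : ℕ) + 1 < n := by omega
      rw [MonoidHom.comp_apply, endo_gen _ hi, artinVal]
      split_ifs with h h'
      · simp [endo_gen _ h2, artinInvVal, h]
      · simp [endo_gen _ h2, endo_gen _ h1, artinInvVal, h']; group
      · simp [endo_gen _ hi, artinInvVal, h, h'])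
    (endo_ext fun i hi => by
      have h1 : (t : ℕ) < n := by omega
      have h2 : (t : ℕ) + 1 < n := by omega
      rw [MonoidHom.comp_apply, endo_gen _ hi, artinInvVal]
      split_ifs with h h'
      · simp [endo_gen _ h2, endo_gen _ h1, artinVal, h]; group
      · simp [endo_gen _ h1, artinVal, h']
      · simp [endo_gen _ hi, artinVal, h, h'])

theorem artinGen_gen (t : Fin (n - 1)) {i : ℕ} (h : i < n) :
    artinGen t (gen n i) = artinVal n t i := endo_gen _ h

theorem artinGen_rels (w : FreeGroup (Fin (n - 1))) (hw : w ∈ braidRels n) :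
    FreeGroup.lift (artinGen (n := n)) w = 1 := by
  rcases hw with ⟨⟨i, hi⟩, ⟨j, hj⟩, hij, rfl⟩ | ⟨⟨i, hi⟩, ⟨j, hj⟩, hij, rfl⟩
  · obtain rfl : i + 1 = j := hij
    simp only [map_mul, map_inv, FreeGroup.lift_apply_of]
    rw [mul_inv_eq_one]
    apply mulAut_gen_ext
    intro l hl
    have h0 : i < n := by omega
    have h1 : i + 1 < n := by omega
    have h2 : i + 1 + 1 < n := by omega
    have e1 : i ≠ i + 1 + 1 := by omega
    have e2 : i + 1 + 1 ≠ i := by omega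
    simp only [MulAut.mul_apply]
    by_cases l0 : l = i
    · subst l0
      simp [artinGen_gen, h0, h1, h2, artinVal, e1, e2]
    by_cases l1 : l = i + 1
    · subst l1
      simp [artinGen_gen, h0, h1, h2, artinVal, e1, e2]
    by_cases l2 : l = i + 1 + 1
    · subst l2
      simp [artinGen_gen, h0, h1, h2, artinVal, e1, e2, mul_assoc]
    · simp [artinGen_gen, hl, artinVal, l0, l1, l2]
  · have hij : i + 2 ≤ j := hij
    simp only [map_mul, map_inv, FreeGroup.lift_apply_of]
    rw [mul_inv_eq_one]
    apply mulAut_gen_ext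
    intro l hl
    have h0 : i < n := by omega
    have h1 : i + 1 < n := by omega
    have h2 : j < n := by omega
    have h3 : j + 1 < n := by omega
    have e1 : i ≠ j := by omega
    have e2 : i ≠ j + 1 := by omega
    have e3 : i + 1 ≠ j := by omega
    simp only [MulAut.mul_apply]
    by_cases l0 : l = i
    · subst l0
      simp [artinGen_gen, h0, h1, artinVal, e1, e2, e3]
    by_cases l1 : l = i + 1
    · subst l1
      simp [artinGen_gen, h0, h1, artinVal, e1, e2, e3]
    by_cases l2 : l = j
    · subst l2
      simp [artinGen_gen, h2, h3, artinVal, e1.symm, e2.symm, e3.symm]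
    by_cases l3 : l = j + 1
    · subst l3
      simp [artinGen_gen, h2, h3, artinVal, e1.symm, e2.symm, e3.symm]
    · simp [artinGen_gen, hl, artinVal, l0, l1, l2, l3]

/-- Artin's representation of the braid group by automorphisms of a free group. -/
def artin (n : ℕ) : BraidGroup n →* MulAut (FreeGroup (Fin n)) :=
  PresentedGroup.toGroup artinGen_rels

theorem artin_sg {t : ℕ} (h : t + 1 < n) : artin n (sg n t) = artinGen ⟨t, by omega⟩ := by
  rw [sg_of_lt (by omega)]
  exact PresentedGroup.toGroup.of artinGen_rels

theorem artin_sg_gen_self {t : ℕ} (h : t + 1 < n) :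
    artin n (sg n t) (gen n t) = gen n (t + 1) := by
  rw [artin_sg h, artinGen_gen _ (by omega)]; simp [artinVal]

theorem artin_sg_gen_succ {t : ℕ} (h : t + 1 < n) :
    artin n (sg n t) (gen n (t + 1)) = (gen n (t + 1))⁻¹ * gen n t * gen n (t + 1) := by
  rw [artin_sg h, artinGen_gen _ h]; simp [artinVal]

theorem artin_sg_gen_of_ne {t i : ℕ} (h : t + 1 < n) (h1 : i ≠ t) (h2 : i ≠ t + 1) :
    artin n (sg n t) (gen n i) = gen n i := by
  by_cases hi : i < n
  · rw [artin_sg h, artinGen_gen _ hi]; simp [artinVal, h1, h2]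
  · simp [gen, hi]

theorem artin_inv_sg_gen_succ {t : ℕ} (h : t + 1 < n) :
    (artin n (sg n t))⁻¹ (gen n (t + 1)) = gen n t := by
  rw [← artin_sg_gen_self h, MulAut.inv_apply_self]

/-- The endomorphism that kills the generator with index `m`. -/
def kill (n m : ℕ) : FreeGroup (Fin n) →* FreeGroup (Fin n) :=
  endo n fun i => if i = m then 1 else gen n i

theorem kill_gen_self (m : ℕ) : kill n m (gen n m) = 1 := by
  by_cases h : m < n
  · rw [kill, endo_gen _ h, if_pos rfl]
  · simp [gen, h]

theorem kill_gen_of_ne {m i : ℕ} (h : i ≠ m) : kill n m (gen n i) = gen n i := by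
  by_cases hi : i < n
  · rw [kill, endo_gen _ hi, if_neg h]
  · simp [gen, hi]

/-- Killing a generator forgets a strand; a crossing changes the label of the forgotten strand and
otherwise only relabels generators. -/
theorem kill_artin_sg {t : ℕ} (h : t + 1 < n) (v : FreeGroup (Fin n)) :
    kill n (t + 1) (artin n (sg n t) v) =
      endo n (fun i => if i = t + 1 then gen n t else gen n i) (kill n t v) := by
  have : (kill n (t + 1)).comp (artin n (sg n t)).toMonoidHom =
      (endo n (fun i => if i = t + 1 then gen n t else gen n i)).comp (kill n t) := by
    refine endo_ext fun i hi => ?_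
    show kill n (t + 1) (artin n (sg n t) (gen n i)) =
      endo n (fun i => if i = t + 1 then gen n t else gen n i) (kill n t (gen n i))
    by_cases h0 : i = t
    · subst h0
      rw [artin_sg_gen_self h, kill_gen_self, kill_gen_self, map_one]
    by_cases h1 : i = t + 1
    · subst h1
      rw [artin_sg_gen_succ h, kill_gen_of_ne (by omega), endo_gen _ h]
      simp [kill_gen_self, kill_gen_of_ne]
    · rw [artin_sg_gen_of_ne h h0 h1, kill_gen_of_ne h1, kill_gen_of_ne h0, endo_gen _ hi, if_neg h1]
  exact DFunLike.congr_fun this v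

theorem artin_bd_gen {r m : ℕ} (hrm : r < m) (hm : m < n) : artin n (bd n r m) (gen n m) =
    (gen n m)⁻¹ * (gen n r)⁻¹ * gen n m * gen n r * gen n m := by
  induction m, hrm using Nat.le_induction with
  | base =>
    rw [bd_self_succ, map_pow, pow_two, MulAut.mul_apply, artin_sg_gen_succ hm]
    simp only [map_mul, map_inv, artin_sg_gen_succ hm, artin_sg_gen_self hm]
    group
  | succ m hrm ih =>
    rw [bd_succ (by omega), map_mul, map_mul, MulAut.mul_apply, MulAut.mul_apply, map_inv,
      artin_inv_sg_gen_succ hm, ih (by omega)]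
    simp only [map_mul, map_inv, artin_sg_gen_self hm,
      artin_sg_gen_of_ne hm (show r ≠ m by omega) (show r ≠ m + 1 by omega)]

theorem kill_artin_bd {r m : ℕ} (hrm : r < m) (hm : m < n) (v : FreeGroup (Fin n)) :
    kill n m (artin n (bd n r m) v) = kill n m v := by
  induction m, hrm using Nat.le_induction generalizing v with
  | base =>
    have : (kill n (r + 1)).comp (artin n (bd n r (r + 1))).toMonoidHom = kill n (r + 1) := by
      refine endo_ext fun i hi => ?_
      show kill n (r + 1) (artin n (bd n r (r + 1)) (gen n i)) = kill n (r + 1) (gen n i)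
      rw [bd_self_succ, map_pow, pow_two, MulAut.mul_apply]
      by_cases h0 : i = r
      · subst h0
        rw [artin_sg_gen_self hm, artin_sg_gen_succ hm]
        simp [kill_gen_self]
      by_cases h1 : i = r + 1
      · subst h1
        rw [artin_sg_gen_succ hm]
        simp [artin_sg_gen_succ hm, artin_sg_gen_self hm, kill_gen_self]
      · rw [artin_sg_gen_of_ne hm h0 h1, artin_sg_gen_of_ne hm h0 h1]
    exact DFunLike.congr_fun this v
  | succ m hrm ih =>
    rw [bd_succ (by omega), map_mul, map_mul, MulAut.mul_apply, MulAut.mul_apply, kill_artin_sg hm,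
      ih (by omega), map_inv, ← kill_artin_sg hm, MulAut.apply_inv_self]

/-- The subgroup of the braid group generated by the `A_{r,m}` with `r < m`. -/
def lastStrand (n m : ℕ) : Subgroup (BraidGroup n) :=
  Subgroup.closure {β | ∃ r < m, β = bd n r m}

/-- The subgroup of the braid group generated by the `σ_t` with `t + 1 < m`. -/
def braidBelow (n m : ℕ) : Subgroup (BraidGroup n) :=
  Subgroup.closure {β | ∃ t, t + 1 < m ∧ β = sg n t}

theorem sg_mem_braidBelow {t m : ℕ} (h : t + 1 < m) : sg n t ∈ braidBelow n m :=
  Subgroup.subset_closure ⟨t, h, rfl⟩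

theorem bd_mem_braidBelow {r s m : ℕ} (hrs : r < s) (h : s < m) : bd n r s ∈ braidBelow n m := by
  induction s, hrs using Nat.le_induction with
  | base => rw [bd_self_succ]; exact pow_mem (sg_mem_braidBelow h) 2
  | succ s hrs ih =>
    rw [bd_succ hrs]
    exact mul_mem (mul_mem (sg_mem_braidBelow h) (ih (by omega))) (inv_mem (sg_mem_braidBelow h))

/-- Conjugation by σ_t exchanges `A_{t,m}` and `A_{t+1,m}` up to conjugation by one of them, since
it fixes their product, and it fixes the other `A_{r,m}`. -/
theorem braidBelow_le_normalizer {m : ℕ} (hm : m < n) :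
    braidBelow n m ≤ Subgroup.normalizer (lastStrand n m : Set (BraidGroup n)) := by
  have mem : ∀ {r}, r < m → bd n r m ∈ lastStrand n m := fun h => Subgroup.subset_closure ⟨_, h, rfl⟩
  have key : ∀ g : BraidGroup n, (∀ r < m, g * bd n r m * g⁻¹ ∈ lastStrand n m) →
      ∀ β ∈ lastStrand n m, g * β * g⁻¹ ∈ lastStrand n m := by
    intro g hg β hβ
    have : lastStrand n m ≤ (lastStrand n m).comap (MulAut.conj g).toMonoidHom := by
      conv_lhs => rw [lastStrand]
      rw [Subgroup.closure_le]
      rintro _ ⟨r, hr, rfl⟩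
      exact hg r hr
    exact this hβ
  rw [braidBelow, Subgroup.closure_le]
  rintro _ ⟨t, ht, rfl⟩
  have h1 := sg_semiconjBy_bd_left ht hm
  have h2 := sg_commute_bd_mul_bd ht hm
  have c1 : sg n t * bd n (t + 1) m * (sg n t)⁻¹ =
      (bd n (t + 1) m)⁻¹ * bd n t m * bd n (t + 1) m := by
    rw [mul_inv_eq_iff_eq_mul, ← mul_left_cancel_iff (a := bd n (t + 1) m), ← mul_assoc, ← h1.eq,
      mul_assoc, h2.eq]
    group
  have c2 : (sg n t)⁻¹ * bd n t m * sg n t = bd n t m * bd n (t + 1) m * (bd n t m)⁻¹ := by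
    have h3 : bd n (t + 1) m = sg n t * bd n t m * (sg n t)⁻¹ := by rw [h1.eq]; group
    rw [eq_mul_inv_iff_mul_eq, ← mul_left_cancel_iff (a := sg n t), h2.eq, h3]
    group
  have hcomm : ∀ r, r < m → r ≠ t → r ≠ t + 1 → Commute (sg n t) (bd n r m) := by
    intro r hr h0 h1
    rcases lt_or_gt_of_ne h0 with h | h
    · exact sg_commute_bd_of_between h ht hm
    · exact sg_commute_bd_of_lt (by omega) hr
  have g1 := key (sg n t) fun r hr => by
    by_cases h0 : r = t
    · subst h0; rw [h1.eq, mul_inv_cancel_right]; exact mem ht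
    by_cases h0' : r = t + 1
    · subst h0'; rw [c1]
      exact mul_mem (mul_mem (inv_mem (mem ht)) (mem (by omega))) (mem ht)
    · rw [(hcomm r hr h0 h0').eq, mul_inv_cancel_right]; exact mem hr
  have g2 := key (sg n t)⁻¹ fun r hr => by
    rw [inv_inv]
    by_cases h0 : r = t
    · subst h0; rw [c2]
      exact mul_mem (mul_mem (mem hr) (mem ht)) (inv_mem (mem hr))
    by_cases h0' : r = t + 1
    · subst h0'; rw [mul_assoc, ← h1.eq, inv_mul_cancel_left]; exact mem (by omega)
    · rw [mul_assoc, ← (hcomm r hr h0 h0').eq, inv_mul_cancel_left]; exact mem hr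
  refine Subgroup.mem_normalizer_iff.2 fun β => ⟨g1 β, fun h => ?_⟩
  have := g2 _ h
  simpa [mul_assoc] using this

/-- The subgroup of the braid group generated by the `A_{r,s}` with `r < s < m`. -/
def bandBelow (n m : ℕ) : Subgroup (BraidGroup n) :=
  Subgroup.closure {β | ∃ r s, r < s ∧ s < m ∧ β = bd n r s}

theorem bandBelow_le_braidBelow (m : ℕ) : bandBelow n m ≤ braidBelow n m := by
  rw [bandBelow, Subgroup.closure_le]
  rintro _ ⟨r, s, hrs, hs, rfl⟩
  exact bd_mem_braidBelow hrs hs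

/-- Artin's combing: the bands ending at strand m generate a subgroup normalized by the earlier
ones, so they can be collected on the left. -/
theorem exists_eq_mul_of_mem_bandBelow {m : ℕ} (hm : m < n) {β : BraidGroup n}
    (hβ : β ∈ bandBelow n (m + 1)) : ∃ u ∈ lastStrand n m, ∃ p ∈ bandBelow n m, β = u * p := by
  have norm : ∀ p ∈ bandBelow n m, ∀ u, u ∈ lastStrand n m ↔ p * u * p⁻¹ ∈ lastStrand n m :=
    fun p hp => Subgroup.mem_normalizer_iff.1
      (braidBelow_le_normalizer hm (bandBelow_le_braidBelow m hp))
  induction hβ using Subgroup.closure_induction with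
  | mem β h =>
    obtain ⟨r, s, hrs, hs, rfl⟩ := h
    rcases (show s ≤ m by omega).eq_or_lt with rfl | h
    · exact ⟨_, Subgroup.subset_closure ⟨r, hrs, rfl⟩, 1, one_mem _, (mul_one _).symm⟩
    · exact ⟨1, one_mem _, _, Subgroup.subset_closure ⟨r, s, hrs, h, rfl⟩, (one_mul _).symm⟩
  | one => exact ⟨1, one_mem _, 1, one_mem _, (mul_one _).symm⟩
  | mul _ _ _ _ h1 h2 =>
    obtain ⟨u, hu, p, hp, rfl⟩ := h1
    obtain ⟨v, hv, q, hq, rfl⟩ := h2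
    exact ⟨u * (p * v * p⁻¹), mul_mem hu ((norm p hp v).1 hv), p * q, mul_mem hp hq, by group⟩
  | inv _ _ h =>
    obtain ⟨u, hu, p, hp, rfl⟩ := h
    refine ⟨p⁻¹ * u⁻¹ * p, ?_, p⁻¹, inv_mem hp, by group⟩
    simpa using (norm p⁻¹ (inv_mem hp) u⁻¹).1 (inv_mem hu)

theorem kill_artin_of_mem_braidBelow {m : ℕ} (hm : m < n) {β : BraidGroup n}
    (hβ : β ∈ braidBelow n m) : artin n β (gen n m) = gen n m ∧
      ∀ v, kill n m (artin n β v) = artin n β (kill n m v) := by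
  induction hβ using Subgroup.closure_induction with
  | mem β h =>
    obtain ⟨t, ht, rfl⟩ := h
    refine ⟨artin_sg_gen_of_ne (by omega) (by omega) (by omega), fun v => ?_⟩
    have : (kill n m).comp (artin n (sg n t)).toMonoidHom =
        (artin n (sg n t)).toMonoidHom.comp (kill n m) := by
      refine endo_ext fun i hi => ?_
      show kill n m (artin n (sg n t) (gen n i)) = artin n (sg n t) (kill n m (gen n i))
      have ht' : t + 1 < n := by omega
      by_cases h0 : i = t
      · subst h0
        rw [artin_sg_gen_self ht', kill_gen_of_ne (by omega), kill_gen_of_ne (by omega),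
          artin_sg_gen_self ht']
      by_cases h1 : i = t + 1
      · subst h1
        rw [artin_sg_gen_succ ht', kill_gen_of_ne (by omega), artin_sg_gen_succ ht']
        simp only [map_mul, map_inv]
        rw [kill_gen_of_ne (by omega), kill_gen_of_ne (by omega)]
      · rw [artin_sg_gen_of_ne ht' h0 h1]
        by_cases h2 : i = m
        · subst h2; rw [kill_gen_self, map_one]
        · rw [kill_gen_of_ne h2, artin_sg_gen_of_ne ht' h0 h1]
    exact DFunLike.congr_fun this v
  | one => simp
  | mul β γ _ _ h1 h2 =>
    rw [map_mul]
    exact ⟨by rw [MulAut.mul_apply, h2.1, h1.1], fun v => by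
      rw [MulAut.mul_apply, MulAut.mul_apply, h1.2, h2.2]⟩
  | inv β _ h =>
    rw [map_inv]
    refine ⟨?_, fun v => ?_⟩
    · conv_lhs => rw [← h.1]
      rw [MulAut.inv_apply_self]
    · have := h.2 ((artin n β)⁻¹ v)
      rw [MulAut.apply_inv_self] at this
      rw [this, MulAut.inv_apply_self]

/-- The homomorphism from a free group onto the subgroup generated by the `A_{r,m}`. -/
def lastStrandHom (n m : ℕ) : FreeGroup (Fin m) →* BraidGroup n := FreeGroup.lift fun r => bd n r m

/-- The word W can be read off from the action: the last generator is conjugated by some w, and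
killing that generator in w leaves the inverse of W. -/
theorem artin_lastStrandHom {m : ℕ} (hm : m < n) (W : FreeGroup (Fin m)) :
    (∀ v, kill n m (artin n (lastStrandHom n m W) v) = kill n m v) ∧
      ∃ w, artin n (lastStrandHom n m W) (gen n m) = w * gen n m * w⁻¹ ∧
        kill n m w = (FreeGroup.map (Fin.castLE hm.le) W)⁻¹ := by
  have base : ∀ r : Fin m, (∀ v, kill n m (artin n (bd n r m) v) = kill n m v) ∧
      ∃ w, artin n (bd n r m) (gen n m) = w * gen n m * w⁻¹ ∧
        kill n m w = (FreeGroup.of (Fin.castLE hm.le r))⁻¹ := by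
    intro r
    refine ⟨kill_artin_bd r.2 hm, (gen n m)⁻¹ * (gen n r)⁻¹, ?_, ?_⟩
    · rw [artin_bd_gen r.2 hm]; group
    · rw [map_mul, map_inv, map_inv, kill_gen_self, kill_gen_of_ne (by omega), of_eq_gen]; simp
  induction W using FreeGroup.induction_on with
  | C1 => exact ⟨by simp, 1, by simp, by simp⟩
  | of r => simpa [lastStrandHom] using base r
  | inv_of r _ =>
    obtain ⟨h1, w, h2, h3⟩ := base r
    have h4 : ∀ v, kill n m ((artin n (bd n r m))⁻¹ v) = kill n m v := fun v => by
      rw [← h1 ((artin n (bd n r m))⁻¹ v), MulAut.apply_inv_self]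
    simp only [lastStrandHom, map_inv, FreeGroup.lift_apply_of]
    refine ⟨h4, ((artin n (bd n r m))⁻¹ w)⁻¹, ?_, ?_⟩
    · have h5 := congrArg (fun v => ((artin n (bd n r m))⁻¹ : MulAut _) v) h2
      rw [MulAut.inv_apply_self, map_mul, map_mul, map_inv] at h5
      rw [inv_inv]
      nth_rewrite 2 [h5]
      group
    · rw [map_inv, h4, h3]; simp
  | mul W V hW hV =>
    obtain ⟨h1, w, h2, h3⟩ := hW
    obtain ⟨k1, v, k2, k3⟩ := hV
    rw [map_mul, map_mul]
    refine ⟨fun a => by rw [MulAut.mul_apply, h1, k1],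
      artin n (lastStrandHom n m W) v * w, ?_, ?_⟩
    · rw [MulAut.mul_apply, k2, map_mul, map_mul, h2, map_inv]; group
    · rw [map_mul, h1, k3, h3, map_mul, mul_inv_rev]

theorem eq_one_of_mem_lastStrand {m : ℕ} (hm : m < n) {u : BraidGroup n}
    (hu : u ∈ lastStrand n m) (h : artin n u = 1) : u = 1 := by
  have hrange : lastStrand n m ≤ (lastStrandHom n m).range := by
    rw [lastStrand, Subgroup.closure_le]
    rintro _ ⟨r, hr, rfl⟩
    exact ⟨FreeGroup.of ⟨r, hr⟩, by simp [lastStrandHom]⟩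
  obtain ⟨W, rfl⟩ := hrange hu
  obtain ⟨-, w, h2, h3⟩ := artin_lastStrandHom hm W
  rw [h, MulAut.one_apply, eq_mul_inv_iff_mul_eq, gen_of_lt hm] at h2
  -- Under a trivial action w commutes with the last generator, hence is a power of it and is
  -- killed; so W is trivial.
  obtain ⟨k, rfl⟩ := mem_zpowers_of_commute_of _ w (Eq.symm h2)
  rw [map_zpow, ← gen_of_lt hm, kill_gen_self, one_zpow, eq_comm, inv_eq_one,
    map_eq_one_iff _ (FreeGroup.map_injective (Fin.castLE_injective hm.le))] at h3
  rw [h3, map_one]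

theorem kill_artin_of_mem_lastStrand {m : ℕ} (hm : m < n) {u : BraidGroup n}
    (hu : u ∈ lastStrand n m) (v : FreeGroup (Fin n)) :
    kill n m (artin n u v) = kill n m v := by
  induction hu using Subgroup.closure_induction generalizing v with
  | mem u h => obtain ⟨r, hr, rfl⟩ := h; exact kill_artin_bd hr hm v
  | one => simp
  | mul a b _ _ ha hb => rw [map_mul, MulAut.mul_apply, ha, hb]
  | inv a _ ha =>
    rw [map_inv, ← ha ((artin n a)⁻¹ v), MulAut.apply_inv_self]

/-- Comb the braid as u p. Killing generator m makes u invisible, so p acts trivially and is 1 by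
induction; then u is 1 as well. -/
theorem artin_eq_one_of_mem_bandBelow {m : ℕ} (hm : m ≤ n) {β : BraidGroup n}
    (hβ : β ∈ bandBelow n m) (h : artin n β = 1) : β = 1 := by
  induction m generalizing β with
  | zero =>
    have : bandBelow n 0 = ⊥ := by
      rw [bandBelow, Subgroup.closure_eq_bot_iff]
      rintro _ ⟨r, s, _, hs, _⟩
      omega
    rwa [this, Subgroup.mem_bot] at hβ
  | succ m ih =>
    obtain ⟨u, hu, p, hp, rfl⟩ := exists_eq_mul_of_mem_bandBelow hm hβ
    have hp' := kill_artin_of_mem_braidBelow hm (bandBelow_le_braidBelow m hp)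
    have hku := kill_artin_of_mem_lastStrand hm hu
    have hpart : artin n p = 1 := by
      refine mulAut_gen_ext fun i hi => ?_
      by_cases him : i = m
      · subst him; exact hp'.1
      · have h1 := DFunLike.congr_fun h (gen n i)
        rw [map_mul, MulAut.mul_apply, MulAut.one_apply] at h1
        have h2 := congrArg (kill n m) h1
        rwa [hku, hp'.2, kill_gen_of_ne him] at h2
    have hp1 := ih (by omega) hp hpart
    rw [hp1, mul_one] at h ⊢
    exact eq_one_of_mem_lastStrand hm hu h

/-- Artin's representation is faithful on the pure braid group. -/
theorem eq_one_of_artin_eq_one {a : PureBraidGroup n} (h : artin n a = 1) : a = 1 := by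
  have ha : (a : BraidGroup n) ∈ bandBelow n n := by
    have : (a : BraidGroup n) ∈ bandSubgroup n := by rw [bandSubgroup_eq_ker]; exact a.2
    exact this
  exact Subtype.ext (artin_eq_one_of_mem_bandBelow le_rfl ha h)

end Artin

/-! ### The full twist -/

section Twists

variable {n : ℕ}

/-- The pure braid `A_{r,s}` for `r < s < n`, and `1` for other values of `r` and `s`. -/
def pureBd (n r s : ℕ) : PureBraidGroup n :=
  if h : r < s ∧ s < n then ⟨bd n r s, MonoidHom.mem_ker.2 (toPerm_bd h.1 h.2)⟩ else 1

theorem coe_pureBd {r s : ℕ} (hrs : r < s) (hs : s < n) :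
    (pureBd n r s : BraidGroup n) = bd n r s := by rw [pureBd, dif_pos ⟨hrs, hs⟩]

theorem pureBd_eq_A {r s : ℕ} (hrs : r < s) (hs : s < n) :
    pureBd n r s = A ⟨r, hrs.trans hs⟩ ⟨s, hs⟩ hrs :=
  Subtype.ext (by rw [coe_pureBd hrs hs, coe_A])

theorem A_eq_pureBd {r s : Fin n} (h : r < s) : A r s h = pureBd n r s :=
  (pureBd_eq_A h s.2).symm

/-- The product `A_{0,s} A_{1,s} ⋯ A_{d-1,s}`. -/
def strandProd (n s : ℕ) : ℕ → PureBraidGroup n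
  | 0 => 1
  | d + 1 => strandProd n s d * pureBd n d s

theorem coe_strandProd_succ_left {s d : ℕ} (hs : s + 1 < n) (hd : d ≤ s) :
    (strandProd n (s + 1) d : BraidGroup n) = sg n s * strandProd n s d * (sg n s)⁻¹ := by
  induction d with
  | zero => simp [strandProd]
  | succ d ih =>
    rw [strandProd, strandProd, Subgroup.coe_mul, Subgroup.coe_mul, ih (by omega),
      coe_pureBd (by omega) hs, coe_pureBd (by omega) (by omega), bd_succ (by omega)]
    group

theorem coe_strandProd_succ {m : ℕ} (hm : m + 1 < n) :
    (strandProd n (m + 1) (m + 1) : BraidGroup n) = sg n m * strandProd n m m * sg n m := by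
  rw [strandProd, Subgroup.coe_mul, coe_strandProd_succ_left hm le_rfl, coe_pureBd (by omega) hm,
    bd_self_succ]
  group

/-- The full twist on the strands `0, …, m`. -/
def fullTwist (n : ℕ) : ℕ → PureBraidGroup n
  | 0 => 1
  | m + 1 => fullTwist n m * strandProd n (m + 1) (m + 1)

/-- The product of the first `m` free generators. -/
def genProd (n : ℕ) : ℕ → FreeGroup (Fin n)
  | 0 => 1
  | m + 1 => genProd n m * gen n m

theorem artin_sg_genProd {t m : ℕ} (ht : t + 1 < n) (hm : m ≠ t + 1) :
    artin n (sg n t) (genProd n m) = genProd n m := by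
  have low : ∀ m ≤ t, artin n (sg n t) (genProd n m) = genProd n m := by
    intro m
    induction m with
    | zero => intro _; simp [genProd]
    | succ m ih =>
      intro h
      rw [genProd, map_mul, ih (by omega), artin_sg_gen_of_ne ht (by omega) (by omega)]
  rcases lt_or_gt_of_ne hm with h | h
  · exact low m (by omega)
  · induction m, h using Nat.le_induction with
    | base =>
      rw [genProd, genProd, map_mul, map_mul, low t le_rfl, artin_sg_gen_self ht,
        artin_sg_gen_succ ht]
      group
    | succ m h ih =>
      rw [genProd, map_mul, ih (by omega), artin_sg_gen_of_ne ht (by omega) (by omega)]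

theorem artin_genProd_self (β : BraidGroup n) : artin n β (genProd n n) = genProd n n := by
  induction β using braid_induction with
  | one => simp
  | mul t ht β ih => rw [map_mul, MulAut.mul_apply, ih, artin_sg_genProd ht (by omega)]
  | inv_mul t ht β ih =>
    rw [map_mul, MulAut.mul_apply, ih, map_inv]
    conv_lhs => rw [← artin_sg_genProd (m := n) ht (by omega)]
    rw [MulAut.inv_apply_self]

theorem artin_strandProd {m : ℕ} (hm : m < n) :
    (∀ i < m, artin n (strandProd n m m) (gen n i) = (gen n m)⁻¹ * gen n i * gen n m) ∧
    artin n (strandProd n m m) (gen n m) =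
      (genProd n (m + 1))⁻¹ * gen n m * genProd n (m + 1) ∧
    (∀ j, m < j → artin n (strandProd n m m) (gen n j) = gen n j) ∧
    ∀ j, m < j → artin n (strandProd n m m) (genProd n j) = genProd n j := by
  induction m with
  | zero => simp [strandProd, genProd]
  | succ m ih =>
    obtain ⟨h1, h2, h3, h4⟩ := ih (by omega)
    rw [coe_strandProd_succ hm, map_mul, map_mul]
    simp only [MulAut.mul_apply]
    refine ⟨fun i hi => ?_, ?_, fun j hj => ?_, fun j hj => ?_⟩
    · rcases (show i ≤ m by omega).eq_or_lt with rfl | hi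
      · rw [artin_sg_gen_self hm, h3 _ (by omega), artin_sg_gen_succ hm]
      · rw [artin_sg_gen_of_ne hm (by omega) (by omega), h1 i hi, map_mul, map_mul, map_inv,
          artin_sg_gen_self hm, artin_sg_gen_of_ne hm (by omega) (by omega)]
    · have h5 : (gen n (m + 1))⁻¹ * ((genProd n (m + 1))⁻¹ * gen n m * genProd n (m + 1)) *
          gen n (m + 1) = (genProd n (m + 2))⁻¹ * gen n m * genProd n (m + 2) := by
        rw [genProd.eq_2 n (m + 1)]; group
      have h6 : artin n (strandProd n m m) ((gen n (m + 1))⁻¹ * gen n m * gen n (m + 1)) =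
          (genProd n (m + 2))⁻¹ * gen n m * genProd n (m + 2) := by
        rw [map_mul, map_mul, map_inv, h2, h3 _ (by omega), h5]
      rw [artin_sg_gen_succ hm, h6, map_mul, map_mul, map_inv, artin_sg_genProd hm (by omega), artin_sg_gen_self hm]
    · rw [artin_sg_gen_of_ne hm (by omega) (by omega), h3 j (by omega),
        artin_sg_gen_of_ne hm (by omega) (by omega)]
    · rw [artin_sg_genProd hm (by omega), h4 j (by omega), artin_sg_genProd hm (by omega)]

theorem artin_fullTwist_gen {m : ℕ} (hm : m < n) :
    (∀ i ≤ m, artin n (fullTwist n m) (gen n i) =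
      (genProd n (m + 1))⁻¹ * gen n i * genProd n (m + 1)) ∧
    (∀ j, m < j → artin n (fullTwist n m) (gen n j) = gen n j) ∧
    ∀ j, m < j → artin n (fullTwist n m) (genProd n j) = genProd n j := by
  induction m with
  | zero => simp [fullTwist, genProd]
  | succ m ih =>
    obtain ⟨h1, h2, h3⟩ := ih (by omega)
    obtain ⟨k1, k2, k3, k4⟩ := artin_strandProd hm
    rw [fullTwist, Subgroup.coe_mul, map_mul]
    simp only [MulAut.mul_apply]
    refine ⟨fun i hi => ?_, fun j hj => ?_, fun j hj => ?_⟩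
    · rcases hi.eq_or_lt with rfl | hi
      · rw [k2, map_mul, map_mul, map_inv, h3 _ (by omega), h2 _ (by omega)]
      · rw [k1 i hi, map_mul, map_mul, map_inv, h2 _ (by omega), h1 i (by omega),
          genProd.eq_2 n (m + 1)]
        group
    · rw [k3 j hj, h2 j (by omega)]
    · rw [k4 j hj, h3 j (by omega)]

theorem artin_fullTwist (hn : 0 < n) :
    artin n (fullTwist n (n - 1)) = MulAut.conj (genProd n n)⁻¹ := by
  refine mulAut_gen_ext fun i hi => ?_
  rw [(artin_fullTwist_gen (show n - 1 < n by omega)).1 i (by omega), Nat.sub_add_cancel hn]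
  simp

/-- By faithfulness this can be checked on the free group, where the full twist conjugates by the
inverse of the product of all generators, an element fixed by every braid. -/
theorem fullTwist_commute (hn : 0 < n) (a : PureBraidGroup n) :
    Commute a (fullTwist n (n - 1)) := by
  have key : artin n ((a * fullTwist n (n - 1) * a⁻¹ * (fullTwist n (n - 1))⁻¹ :
      PureBraidGroup n) : BraidGroup n) = 1 := by
    push_cast
    rw [map_mul, map_mul, map_mul, map_inv, map_inv, artin_fullTwist hn, mul_inv_eq_one]
    ext v
    simp [MulAut.mul_apply, artin_genProd_self]
  have := eq_one_of_artin_eq_one key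
  rw [mul_inv_eq_one, mul_inv_eq_iff_eq_mul] at this
  exact this

end Twists

/-! ### A linking number that detects the full twist -/

section Linking

variable {n : ℕ}

/-- The cocycle that counts the crossings of two strands at which the first one is on the left. -/
def linkingCocycle (n : ℕ) : BraidCocycle n (Fin n × Fin n) (Multiplicative ℤ) where
  val t ω := Multiplicative.ofAdd (if (ω.1 : ℕ) = t ∧ (ω.2 : ℕ) = t + 1 then 1 else 0)
  braid i j hij ω := by
    simp only [Prod.smul_fst, Prod.smul_snd, Equiv.Perm.smul_def, adjSwap, Equiv.swap_apply_def,
      Fin.ext_iff, ← ofAdd_add, EmbeddingLike.apply_eq_iff_eq]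
    grind
  comm i j hij ω := by
    simp only [Prod.smul_fst, Prod.smul_snd, Equiv.Perm.smul_def, adjSwap, Equiv.swap_apply_def,
      Fin.ext_iff, ← ofAdd_add, EmbeddingLike.apply_eq_iff_eq]
    grind

theorem linkingCocycle_bd {r s : ℕ} (hrs : r < s) (hs : s < n) (ω : Fin n × Fin n) :
    (linkingCocycle n).ext (bd n r s) ω = Multiplicative.ofAdd
      (if ((ω.1 : ℕ) = r ∧ (ω.2 : ℕ) = s) ∨ ((ω.1 : ℕ) = s ∧ (ω.2 : ℕ) = r) then 1 else 0) := by
  induction s, hrs using Nat.le_induction generalizing ω with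
  | base =>
    rw [BraidCocycle.ext_bd_self _ (by omega)]
    simp only [linkingCocycle, Prod.smul_fst, Prod.smul_snd, Equiv.Perm.smul_def, adjSwap,
      Equiv.swap_apply_def, Fin.ext_iff, ← ofAdd_add, EmbeddingLike.apply_eq_iff_eq]
    grind
  | succ s hrs ih =>
    rw [BraidCocycle.ext_bd_succ _ hrs (by omega), mul_comm, inv_mul_cancel_left, ih (by omega)]
    simp only [Prod.smul_fst, Prod.smul_snd, Equiv.Perm.smul_def, adjSwap,
      Equiv.swap_apply_def, Fin.ext_iff, EmbeddingLike.apply_eq_iff_eq]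
    grind

/-- The linking number of the first two strands of a pure braid. -/
def linking (hn : 2 ≤ n) : PureBraidGroup n →* Multiplicative ℤ :=
  (linkingCocycle n).pure (⟨0, by omega⟩, ⟨1, by omega⟩)

theorem linking_pureBd (hn : 2 ≤ n) {r s : ℕ} (hrs : r < s) (hs : s < n) :
    linking hn (pureBd n r s) = Multiplicative.ofAdd (if r = 0 ∧ s = 1 then 1 else 0) := by
  show (linkingCocycle n).ext (pureBd n r s) _ = _
  rw [coe_pureBd hrs hs, linkingCocycle_bd hrs hs]
  congr 2
  simp only [eq_iff_iff]
  omega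

theorem linking_strandProd (hn : 2 ≤ n) {s d : ℕ} (hs : s < n) (hd : d ≤ s) (h : s ≠ 1) :
    linking hn (strandProd n s d) = 1 := by
  induction d with
  | zero => exact map_one _
  | succ d ih =>
    rw [strandProd, map_mul, ih (by omega), linking_pureBd hn (by omega) hs, if_neg (by omega)]
    rfl

/-- Only the factor `A_{0,1}` contributes, and it occurs once. The value 1 lets linking split off
the powers of the full twist. -/
theorem linking_fullTwist (hn : 2 ≤ n) {m : ℕ} (hm : m + 1 < n) :
    linking hn (fullTwist n (m + 1)) = Multiplicative.ofAdd 1 := by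
  induction m with
  | zero =>
    rw [fullTwist, fullTwist, strandProd, strandProd, one_mul, one_mul,
      linking_pureBd hn (by omega) hm, if_pos ⟨rfl, rfl⟩]
  | succ m ih =>
    rw [fullTwist, map_mul, ih (by omega), linking_strandProd hn hm le_rfl (by omega), mul_one]

end Linking

/-! ### Exchanging the last puncture with the one at infinity, on the free group -/

section Exchange

variable {n : ℕ}

/-- The values of `lastFlip`. -/
def lastFlipVal (n i : ℕ) : FreeGroup (Fin n) :=
  if i = n - 1 then (gen n (n - 1))⁻¹ * (genProd n (n - 1))⁻¹ else gen n i

/-- The values of the inverse of `lastFlip`. -/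
def lastFlipInvVal (n i : ℕ) : FreeGroup (Fin n) :=
  if i = n - 1 then (genProd n (n - 1))⁻¹ * (gen n (n - 1))⁻¹ else gen n i

theorem endo_genProd {v : ℕ → FreeGroup (Fin n)} {m : ℕ} (hm : m ≤ n)
    (h : ∀ i < m, v i = gen n i) : endo n v (genProd n m) = genProd n m := by
  induction m with
  | zero => exact map_one _
  | succ m ih =>
    rw [genProd, map_mul, ih (by omega) fun i hi => h i (by omega), endo_gen _ hm, h m (by omega)]

/-- The automorphism that fixes all free generators but the last one, `a`, and takes `a` to
`a⁻¹ w⁻¹`, where `w` is the product of the others. -/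
def lastFlip (n : ℕ) : MulAut (FreeGroup (Fin n)) :=
  MonoidHom.toMulEquiv (endo n (lastFlipVal n)) (endo n (lastFlipInvVal n))
    (endo_ext fun i hi => by
      rw [MonoidHom.comp_apply, endo_gen _ hi, lastFlipVal]
      split_ifs with h
      · rw [map_mul, map_inv, map_inv, endo_gen _ (by omega), endo_genProd (by omega), lastFlipInvVal,
          if_pos rfl, MonoidHom.id_apply, h]
        · group
        · intro i hi; rw [lastFlipInvVal, if_neg (by omega)]
      · rw [endo_gen _ hi, lastFlipInvVal, if_neg h]; rfl)
    (endo_ext fun i hi => by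
      rw [MonoidHom.comp_apply, endo_gen _ hi, lastFlipInvVal]
      split_ifs with h
      · rw [map_mul, map_inv, map_inv, endo_gen _ (by omega), endo_genProd (by omega), lastFlipVal,
          if_pos rfl, MonoidHom.id_apply, h]
        · group
        · intro i hi; rw [lastFlipVal, if_neg (by omega)]
      · rw [endo_gen _ hi, lastFlipVal, if_neg h]; rfl)

theorem lastFlip_gen_of_ne {i : ℕ} (h : i ≠ n - 1) : lastFlip n (gen n i) = gen n i := by
  by_cases hi : i < n
  · exact (endo_gen _ hi).trans (if_neg h)
  · simp [gen, hi]

theorem lastFlip_gen_last (hn : 0 < n) :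
    lastFlip n (gen n (n - 1)) = (gen n (n - 1))⁻¹ * (genProd n (n - 1))⁻¹ :=
  (endo_gen _ (by omega)).trans (if_pos rfl)

theorem lastFlip_genProd {m : ℕ} (h : m ≤ n - 1) : lastFlip n (genProd n m) = genProd n m :=
  endo_genProd (by omega) fun i hi => if_neg (by omega)

theorem genProd_eq (hn : 0 < n) : genProd n n = genProd n (n - 1) * gen n (n - 1) := by
  obtain ⟨m, rfl⟩ := Nat.exists_eq_succ_of_ne_zero hn.ne'
  rfl

/-- The product of all generators is primitive: `lastFlip` sends the last generator to its inverse,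
so the centralizer of a free generator can be transported. -/
theorem mem_zpowers_of_commute_genProd (hn : 0 < n) {w : FreeGroup (Fin n)}
    (h : Commute w (genProd n n)) : w ∈ Subgroup.zpowers (genProd n n) := by
  have h1 : lastFlip n (gen n (n - 1)) = (genProd n n)⁻¹ := by
    rw [lastFlip_gen_last hn, genProd_eq hn, mul_inv_rev]
  have h2 : gen n (n - 1) = (lastFlip n)⁻¹ (genProd n n)⁻¹ := by
    rw [← h1, MulAut.inv_apply_self]
  have h3 : Commute ((lastFlip n)⁻¹ w) (gen n (n - 1)) := by
    rw [h2]; exact h.inv_right.map (lastFlip n)⁻¹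
  rw [gen_of_lt (show n - 1 < n by omega)] at h3
  obtain ⟨k, hk⟩ := mem_zpowers_of_commute_of _ _ h3
  refine ⟨-k, ?_⟩
  have h4 : lastFlip n ((lastFlip n)⁻¹ w) = w := MulAut.apply_inv_self _ _ _
  simp only at hk ⊢
  rw [← h4, ← hk, ← gen_of_lt, map_zpow, h1, zpow_neg, inv_zpow]

theorem lastFlip_commute {t : ℕ} (ht : t + 2 < n) : Commute (lastFlip n) (artin n (sg n t)) := by
  refine mulAut_gen_ext fun i hi => ?_
  have ht' : t + 1 < n := by omega
  rw [MulAut.mul_apply, MulAut.mul_apply]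
  by_cases h : i = n - 1
  · subst h
    rw [artin_sg_gen_of_ne ht' (by omega) (by omega), lastFlip_gen_last (by omega), map_mul, map_inv,
      map_inv, artin_sg_gen_of_ne ht' (by omega) (by omega), artin_sg_genProd ht' (by omega)]
  rw [lastFlip_gen_of_ne h]
  by_cases h0 : i = t
  · subst h0; rw [artin_sg_gen_self ht', lastFlip_gen_of_ne (by omega)]
  by_cases h1 : i = t + 1
  · subst h1
    rw [artin_sg_gen_succ ht', map_mul, map_mul, map_inv, lastFlip_gen_of_ne (by omega),
      lastFlip_gen_of_ne (by omega)]
  · rw [artin_sg_gen_of_ne ht' h0 h1, lastFlip_gen_of_ne h]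

/-- With its commutation relations, this makes `lastFlip` behave like one further Artin generator, a
half twist with the puncture at infinity. -/
theorem lastFlip_braid {c : ℕ} : lastFlip (c + 2) * artin (c + 2) (sg (c + 2) c) * lastFlip (c + 2) =
    artin (c + 2) (sg (c + 2) c) * lastFlip (c + 2) * artin (c + 2) (sg (c + 2) c) := by
  have hc : c + 1 < c + 2 := by omega
  have f1 : lastFlip (c + 2) (gen (c + 2) (c + 1)) =
      (gen (c + 2) (c + 1))⁻¹ * (gen (c + 2) c)⁻¹ * (genProd (c + 2) c)⁻¹ := by
    have := lastFlip_gen_last (n := c + 2) (by omega)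
    simpa [genProd, mul_assoc] using this
  have f0 : lastFlip (c + 2) (gen (c + 2) c) = gen (c + 2) c := lastFlip_gen_of_ne (by omega)
  have fu : lastFlip (c + 2) (genProd (c + 2) c) = genProd (c + 2) c := lastFlip_genProd (by omega)
  have su : artin (c + 2) (sg (c + 2) c) (genProd (c + 2) c) = genProd (c + 2) c :=
    artin_sg_genProd hc (by omega)
  have s0 := artin_sg_gen_self hc
  have s1 := artin_sg_gen_succ hc
  refine mulAut_gen_ext fun i hi => ?_
  simp only [MulAut.mul_apply]
  by_cases h1 : i = c + 1
  · subst h1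
    simp only [f1, f0, fu, su, s0, s1, map_mul, map_inv]
    group
  by_cases h0 : i = c
  · subst h0
    simp only [f1, f0, su, s0, s1, map_mul, map_inv]
    group
  · have f := lastFlip_gen_of_ne (n := c + 2) (i := i) (by omega)
    have s := artin_sg_gen_of_ne hc h0 h1
    simp only [f, s]

/-- On the sphere, carrying the last puncture around all other strands undoes carrying it around
infinity; so, up to inner automorphisms, the square of `lastFlip` is the inverse of a pure braid. -/
theorem conj_mul_artin_strandProd_mul_lastFlip_sq (hn : 0 < n) :
    MulAut.conj (gen n (n - 1)) * artin n (strandProd n (n - 1) (n - 1)) * (lastFlip n * lastFlip n) =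
      1 := by
  obtain ⟨h1, h2, h3, h4⟩ := artin_strandProd (show n - 1 < n by omega)
  rw [Nat.sub_add_cancel hn] at h2
  refine mulAut_gen_ext fun i hi => ?_
  simp only [MulAut.mul_apply, MulAut.one_apply]
  by_cases h : i = n - 1
  · subst h
    have h5 : lastFlip n (lastFlip n (gen n (n - 1))) =
        genProd n n * gen n (n - 1) * (genProd n n)⁻¹ := by
      rw [lastFlip_gen_last hn, map_mul, map_inv, map_inv, lastFlip_gen_last hn, lastFlip_genProd le_rfl,
        genProd_eq hn]
      group
    rw [h5]
    simp only [map_mul, map_inv, artin_genProd_self, h2]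
    rw [genProd_eq hn, MulAut.conj_apply]
    simp
    group
  · rw [lastFlip_gen_of_ne h, lastFlip_gen_of_ne h, h1 i (by omega)]
    simp [mul_assoc]

end Exchange

theorem exists_mulEquiv_of_conj {G H : Type*} [Group G] [Group H] {q : G →* H}
    (hq : Function.Injective q) {t : H} (h1 : ∀ a, t * q a * t⁻¹ ∈ q.range)
    (h2 : ∀ a, t⁻¹ * q a * t ∈ q.range) : ∃ φ : G ≃* G, ∀ a, q (φ a) = t * q a * t⁻¹ := by
  choose f hf using h1
  choose g hg using h2
  exact ⟨{ toFun := f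
           invFun := g
           left_inv := fun a => hq (by rw [hg, hf]; group)
           right_inv := fun a => hq (by rw [hf, hg]; group)
           map_mul' := fun a b => hq (by rw [hf, map_mul, map_mul, hf, hf]; group) }, hf⟩

instance conj_range_normal (G : Type*) [Group G] : (MulAut.conj (G := G)).range.Normal where
  conj_mem := by
    rintro _ ⟨w, rfl⟩ φ
    refine ⟨φ w, ?_⟩
    ext v
    simp [MulAut.mul_apply]

theorem conj_conj_of_commute {G : Type*} [Group G] {a b : G} (h : Commute a b) (v : G) :
    a * (b * v * b⁻¹) * a⁻¹ = b * (a * v * a⁻¹) * b⁻¹ := by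
  have h1 := h.eq
  have h2 := h.inv_inv.eq
  calc a * (b * v * b⁻¹) * a⁻¹ = (a * b) * v * (b⁻¹ * a⁻¹) := by group
    _ = (b * a) * v * (a⁻¹ * b⁻¹) := by rw [h1, h2]
    _ = _ := by group

theorem conj_eq_of_braid {G : Type*} [Group G] {a b : G} (h : a * b * a = b * a * b) :
    a * b * a⁻¹ = b⁻¹ * a * b := by
  rw [mul_inv_eq_iff_eq_mul, mul_assoc, mul_assoc, eq_inv_mul_iff_mul_eq, ← mul_assoc, ← mul_assoc,
    h]

theorem conj_inv_eq_of_braid {G : Type*} [Group G] {a b : G} (h : a * b * a = b * a * b) :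
    a⁻¹ * b * a = b * a * b⁻¹ := by
  rw [eq_mul_inv_iff_mul_eq, mul_assoc, mul_assoc, inv_mul_eq_iff_eq_mul, ← mul_assoc,
    ← mul_assoc, h]

/-! ### Embedding P_n in Out(F_n) × ℤ -/

section Exchange

variable {n : ℕ}

/-- The homomorphism from the braid group to the outer automorphism group of a free group. -/
def outer (n : ℕ) :
    BraidGroup n →* MulAut (FreeGroup (Fin n)) ⧸ (MulAut.conj (G := FreeGroup (Fin n))).range :=
  (QuotientGroup.mk' _).comp (artin n)

/-- If a acts as conjugation by w, then w commutes with the fixed product of all generators and is a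
power of it, and powers of the full twist realize exactly such conjugations. -/
theorem exists_zpow_fullTwist {a : PureBraidGroup n} (hn : 0 < n) (h : outer n a = 1) :
    ∃ k : ℤ, a = fullTwist n (n - 1) ^ k := by
  obtain ⟨w, hw⟩ := (QuotientGroup.eq_one_iff _).1 h
  have h1 := artin_genProd_self (n := n) a
  rw [← hw, MulAut.conj_apply, mul_inv_eq_iff_eq_mul] at h1
  obtain ⟨k, rfl⟩ := mem_zpowers_of_commute_genProd hn h1
  refine ⟨-k, ?_⟩
  have h2 : artin n ((a * fullTwist n (n - 1) ^ k : PureBraidGroup n) : BraidGroup n) = 1 := by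
    push_cast
    rw [map_mul, map_zpow, artin_fullTwist hn, ← hw, ← map_zpow, ← map_mul, inv_zpow,
      mul_inv_cancel, map_one]
  rw [zpow_neg]
  exact eq_inv_of_mul_eq_one_left (eq_one_of_artin_eq_one h2)

theorem outer_fullTwist (hn : 0 < n) : outer n (fullTwist n (n - 1)) = 1 :=
  (QuotientGroup.eq_one_iff _).2 ⟨_, (artin_fullTwist hn).symm⟩

/-- The outer class of a pure braid together with a linking number. -/
def outerLinking (hn : 2 ≤ n) : PureBraidGroup n →*
    (MulAut (FreeGroup (Fin n)) ⧸ (MulAut.conj (G := FreeGroup (Fin n))).range) ×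
      Multiplicative ℤ :=
  ((outer n).comp (toPerm n).ker.subtype).prod (linking hn)

theorem linking_fullTwist_last (hn : 2 ≤ n) :
    linking hn (fullTwist n (n - 1)) = Multiplicative.ofAdd 1 := by
  have := linking_fullTwist hn (m := n - 2) (by omega)
  rwa [show n - 2 + 1 = n - 1 by omega] at this

theorem outerLinking_injective (hn : 2 ≤ n) : Function.Injective (outerLinking hn) := by
  rw [injective_iff_map_eq_one]
  intro a ha
  obtain ⟨h1, h2⟩ := Prod.mk_eq_one.1 (show (outer n a, linking hn a) = 1 from ha)
  obtain ⟨k, rfl⟩ := exists_zpow_fullTwist (by omega) h1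
  rw [map_zpow, linking_fullTwist_last hn] at h2
  have hk : k = 0 := by simpa using congrArg Multiplicative.toAdd h2
  rw [hk, zpow_zero]

/-- Powers of the full twist adjust the linking number without changing the outer class, so
membership in the image depends on the first coordinate only. -/
theorem mem_range_outerLinking (hn : 2 ≤ n) {a : PureBraidGroup n} (m : Multiplicative ℤ) :
    (outer n a, m) ∈ (outerLinking hn).range := by
  refine ⟨a * fullTwist n (n - 1) ^ (m / linking hn a).toAdd, ?_⟩
  refine Prod.ext ?_ ?_
  · show outer n ((a : BraidGroup n) * (fullTwist n (n - 1) : BraidGroup n) ^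
      (m / linking hn a).toAdd) = outer n a
    rw [map_mul, map_zpow, outer_fullTwist (by omega),
      one_zpow, mul_one]
  · show linking hn _ = m
    rw [map_mul, map_zpow, linking_fullTwist_last hn, ← ofAdd_zsmul]
    simp

/-- The outer class of `lastFlip`. -/
def outerFlip (n : ℕ) :
    MulAut (FreeGroup (Fin n)) ⧸ (MulAut.conj (G := FreeGroup (Fin n))).range :=
  QuotientGroup.mk' _ (lastFlip n)

theorem outerFlip_commute {t : ℕ} (ht : t + 2 < n) : Commute (outerFlip n) (outer n (sg n t)) :=
  (lastFlip_commute ht).map (QuotientGroup.mk' _)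

theorem outerFlip_commute_bd {r s : ℕ} (hrs : r < s) (hs : s + 1 < n) :
    Commute (outerFlip n) (outer n (bd n r s)) := by
  induction s, hrs using Nat.le_induction with
  | base => rw [bd_self_succ, map_pow]; exact (outerFlip_commute hs).pow_right 2
  | succ s hrs ih =>
    rw [bd_succ hrs, map_mul, map_mul, map_inv]
    have h := outerFlip_commute (n := n) (t := s) (by omega)
    exact (h.mul_right (ih (by omega))).mul_right h.inv_right

theorem outerFlip_braid {c : ℕ} :
    outerFlip (c + 2) * outer (c + 2) (sg (c + 2) c) * outerFlip (c + 2) =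
      outer (c + 2) (sg (c + 2) c) * outerFlip (c + 2) * outer (c + 2) (sg (c + 2) c) :=
  congrArg (QuotientGroup.mk' _) lastFlip_braid

theorem outerFlip_sq {c : ℕ} : outerFlip (c + 2) * outerFlip (c + 2) =
    (outer (c + 2) (strandProd (c + 2) (c + 1) (c + 1)))⁻¹ := by
  have h := conj_mul_artin_strandProd_mul_lastFlip_sq (n := c + 2) (by omega)
  have h2 := congrArg (QuotientGroup.mk' (MulAut.conj (G := FreeGroup (Fin (c + 2)))).range) h
  rw [map_mul, map_mul, map_one, map_mul] at h2
  rw [show QuotientGroup.mk' (MulAut.conj (G := FreeGroup (Fin (c + 2)))).range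
    (MulAut.conj (gen (c + 2) (c + 2 - 1))) = 1 from
    (QuotientGroup.eq_one_iff _).2 ⟨_, rfl⟩, one_mul] at h2
  exact eq_inv_of_mul_eq_one_right h2

theorem exists_outer_conj (β : BraidGroup n) (a : PureBraidGroup n) :
    ∃ b : PureBraidGroup n, outer n b = outer n β * outer n a * (outer n β)⁻¹ :=
  ⟨MulAut.conjNormal β a, by simp⟩

/-- Bands away from the last strand commute with the flip τ. For `A_{c,c+1}`, the square of σ = σ_c,
the braid relation turns a τ-conjugate of σ² into a σ-conjugate of τ², which is the class of a pure
braid; conjugation by generators commuting with τ reaches the other bands. -/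
theorem exists_outer_flip_conj_bd {c r s : ℕ} (hrs : r < s) (hs : s < c + 2) :
    (∃ b : PureBraidGroup (c + 2), outer (c + 2) b =
      outerFlip (c + 2) * outer (c + 2) (bd (c + 2) r s) * (outerFlip (c + 2))⁻¹) ∧
    ∃ b : PureBraidGroup (c + 2), outer (c + 2) b =
      (outerFlip (c + 2))⁻¹ * outer (c + 2) (bd (c + 2) r s) * outerFlip (c + 2) := by
  set τ := outerFlip (c + 2) with hτ
  rcases (show s ≤ c + 1 by omega).lt_or_eq with h | rfl
  · have hc := outerFlip_commute_bd hrs (n := c + 2) (by omega)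
    refine ⟨⟨pureBd _ r s, ?_⟩, ⟨pureBd _ r s, ?_⟩⟩
    · rw [coe_pureBd hrs hs, hc.eq, mul_inv_cancel_right]
    · rw [coe_pureBd hrs hs, mul_assoc, ← hc.eq, inv_mul_cancel_left]
  · obtain ⟨d, hd⟩ : ∃ d, c = r + d := Nat.exists_eq_add_of_le (by omega)
    clear hrs
    induction d generalizing r with
    | zero =>
      obtain rfl : c = r := hd
      have hb := outerFlip_braid (c := c)
      have hL := outerFlip_sq (c := c)
      rw [← hτ] at hb hL
      rw [bd_self_succ, map_pow]
      set σ := outer (c + 2) (sg (c + 2) c) with hσ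
      constructor
      · obtain ⟨b, hb'⟩ := exists_outer_conj (sg (c + 2) c)⁻¹ (strandProd (c + 2) (c + 1) (c + 1))⁻¹
        refine ⟨b, ?_⟩
        simp only [Subgroup.coe_inv, map_inv, ← hL, ← hσ] at hb'
        rw [hb', ← conj_pow, conj_eq_of_braid hb, pow_two]
        group
      · obtain ⟨b, hb'⟩ := exists_outer_conj (sg (c + 2) c) (strandProd (c + 2) (c + 1) (c + 1))⁻¹
        refine ⟨b, ?_⟩
        have h1 := conj_pow (i := 2) (a := τ⁻¹) (b := σ)
        rw [inv_inv] at h1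
        simp only [Subgroup.coe_inv, map_inv, ← hL, ← hσ] at hb'
        rw [hb', ← h1, conj_inv_eq_of_braid hb, pow_two]
        group
    | succ d ih =>
      have hcomm := outerFlip_commute (n := c + 2) (t := r) (by omega)
      rw [← hτ] at hcomm
      have hbd : bd (c + 2) r (c + 1) =
          (sg (c + 2) r)⁻¹ * bd (c + 2) (r + 1) (c + 1) * (sg (c + 2) r)⁻¹⁻¹ := by
        rw [inv_inv, mul_assoc, ← (sg_semiconjBy_bd_left (by omega) hs).eq, inv_mul_cancel_left]
      obtain ⟨⟨b, hb⟩, ⟨b', hb'⟩⟩ := ih (r := r + 1) (by omega)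
      obtain ⟨e, he⟩ := exists_outer_conj (sg (c + 2) r)⁻¹ b
      obtain ⟨e', he'⟩ := exists_outer_conj (sg (c + 2) r)⁻¹ b'
      refine ⟨⟨e, ?_⟩, ⟨e', ?_⟩⟩
      · rw [he, hb, hbd]
        simp only [map_mul, map_inv]
        exact conj_conj_of_commute hcomm.inv_right.symm _
      · rw [he', hb', hbd]
        simp only [map_mul, map_inv]
        simpa using conj_conj_of_commute hcomm.inv_inv.symm (outer (c + 2) (bd (c + 2) (r + 1) (c + 1)))


end Exchange

/-! ### The exchange automorphism and the passage from four strands to three -/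

section Exchange

variable {n : ℕ}

/-- An automorphism of the pure braid group that fixes the `A_{r,s}` with `s` not the last strand
and takes `A_{c,c+1}`, where `c + 1` is the last strand, to `(A_{0,c} ⋯ A_{c-1,c} A_{c,c+1})⁻¹` up to
a power of the full twist. -/
theorem exists_mulEquiv_exchange (c : ℕ) :
    ∃ (φ : PureBraidGroup (c + 2) ≃* PureBraidGroup (c + 2)) (k : ℤ),
      (∀ r s, r < s → s < c + 1 → φ (pureBd (c + 2) r s) = pureBd (c + 2) r s) ∧
      φ (pureBd (c + 2) c (c + 1)) =
        (strandProd (c + 2) c c * pureBd (c + 2) c (c + 1))⁻¹ * fullTwist (c + 2) (c + 1) ^ k := by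
  have hn : 2 ≤ c + 2 := by omega
  have hinj := outerLinking_injective hn
  -- The trivial second coordinate makes the automorphism preserve the linking number, so comparing
  -- outer classes suffices to identify values.
  set t := (outerFlip (c + 2), (1 : Multiplicative ℤ)) with ht
  have key : ∀ u, (∀ r s, r < s → s < c + 2 →
      u * outerLinking hn (pureBd (c + 2) r s) * u⁻¹ ∈ (outerLinking hn).range) →
      ∀ a, u * outerLinking hn a * u⁻¹ ∈ (outerLinking hn).range := by
    intro u hu a
    have : (⊤ : Subgroup (PureBraidGroup (c + 2))) ≤
        (outerLinking hn).range.comap ((MulAut.conj u).toMonoidHom.comp (outerLinking hn)) := by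
      rw [← closure_A, Subgroup.closure_le]
      rintro _ ⟨r, s, h, rfl⟩
      rw [A_eq_pureBd h]
      exact hu r s h s.2
    exact this (Subgroup.mem_top a)
  have h1 := key t fun r s hrs hs => by
    obtain ⟨b, hb⟩ := (exists_outer_flip_conj_bd hrs hs).1
    have := mem_range_outerLinking hn (a := b) (linking hn (pureBd (c + 2) r s))
    rw [hb, ← coe_pureBd hrs hs] at this
    convert this using 1
    refine Prod.ext rfl ?_
    show 1 * linking hn (pureBd (c + 2) r s) * 1⁻¹ = _
    simp
  have h2 := key t⁻¹ fun r s hrs hs => by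
    obtain ⟨b, hb⟩ := (exists_outer_flip_conj_bd hrs hs).2
    have := mem_range_outerLinking hn (a := b) (linking hn (pureBd (c + 2) r s))
    rw [hb, ← coe_pureBd hrs hs] at this
    convert this using 1
    rw [inv_inv]
    refine Prod.ext rfl ?_
    show 1⁻¹ * linking hn (pureBd (c + 2) r s) * 1 = _
    simp
  obtain ⟨φ, hφ⟩ := exists_mulEquiv_of_conj hinj h1 (fun a => by simpa using h2 a)
  have hφ' : ∀ a, outer (c + 2) (φ a) =
      outerFlip (c + 2) * outer (c + 2) a * (outerFlip (c + 2))⁻¹ :=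
    fun a => congrArg Prod.fst (hφ a)
  have hφ'' : ∀ a, linking hn (φ a) = linking hn a := fun a => by
    have : linking hn (φ a) = 1 * linking hn a * 1⁻¹ := congrArg Prod.snd (hφ a)
    simpa using this
  -- The first factor is the conjugate of the long strand product by the inverse of σ_c, and φ of
  -- the band is the conjugate of τ², the inverse of that product. Equality thus holds up to a power
  -- of the full twist.
  have htwist : outer (c + 2) (((strandProd (c + 2) c c * pureBd (c + 2) c (c + 1)) *
      φ (pureBd (c + 2) c (c + 1)) : PureBraidGroup (c + 2)) : BraidGroup (c + 2)) = 1 := by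
    have e1 : ((strandProd (c + 2) c c * pureBd (c + 2) c (c + 1) : PureBraidGroup (c + 2)) :
        BraidGroup (c + 2)) = (sg (c + 2) c)⁻¹ *
          strandProd (c + 2) (c + 1) (c + 1) * sg (c + 2) c := by
      rw [coe_strandProd_succ (by omega), Subgroup.coe_mul, coe_pureBd (by omega) (by omega),
        bd_self_succ, pow_two]
      group
    rw [Subgroup.coe_mul, e1, map_mul, hφ', coe_pureBd (by omega) (by omega), bd_self_succ, map_pow,
      ← conj_pow, conj_eq_of_braid outerFlip_braid, map_mul, map_mul, map_inv,
      ← inv_inv (outer (c + 2) (strandProd (c + 2) (c + 1) (c + 1))), ← outerFlip_sq, pow_two]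
    group
  obtain ⟨k, hk⟩ := exists_zpow_fullTwist (by omega) htwist
  refine ⟨φ, k, fun r s hrs hs => ?_, ?_⟩
  · apply hinj
    refine Prod.ext ?_ (hφ'' _)
    show outer (c + 2) (φ (pureBd (c + 2) r s)) = outer (c + 2) (pureBd (c + 2) r s)
    rw [hφ', coe_pureBd hrs (by omega), (outerFlip_commute_bd hrs (by omega)).eq,
      mul_inv_cancel_right]
  · exact eq_inv_mul_of_mul_eq hk

theorem standardHom_pureBd_eq_one {I : Finset (Fin n)} {r s : ℕ}
    (h : ∀ (hr : r < n) (hs : s < n), ¬(⟨r, hr⟩ ∈ I ∧ ⟨s, hs⟩ ∈ I)) :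
    standardHom I (pureBd n r s) = 1 := by
  by_cases hrs : r < s ∧ s < n
  · rw [pureBd_eq_A hrs.1 hrs.2]
    exact standardHom_A_eq_one _ (h _ _)
  · rw [pureBd, dif_neg hrs, map_one]

theorem eq_one_of_forall_commute {w : F 2} (h : ∀ v, Commute v w) : w = 1 :=
  eq_one_of_commute_of_commute (show (0 : Fin 2) ≠ 1 by decide) (h _).symm (h _).symm

theorem standardHom_A_ne_one {I : Finset (Fin n)} (hI : I.card = 3 ∨ I.card = 4) {r s : Fin n}
    (h : r < s) (hr : r ∈ I) (hs : s ∈ I) : standardHom I (A r s h) ≠ 1 := by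
  have hx : x ≠ 1 := FreeGroup.of_ne_one 0
  have hy : y ≠ 1 := FreeGroup.of_ne_one 1
  have hyx : y⁻¹ * x⁻¹ ≠ 1 := fun h => by
    have := congrArg (FreeGroup.lift fun _ => Multiplicative.ofAdd (1 : ℤ)) h
    simp [x, y, ← ofAdd_neg, ← ofAdd_add] at this
  have hxy : x * y * x⁻¹ ≠ 1 := by simpa using hy
  rcases isStandard_standardHom hI with ⟨i, j, k, hij, hjk, rfl, hf⟩ |
    ⟨i, j, k, l, hij, hjk, hkl, rfl, hf⟩
  · rw [hf r s h, value₃]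
    simp only [Finset.mem_insert, Finset.mem_singleton] at hr hs
    split_ifs <;> first | assumption | (exfalso; omega)
  · rw [hf r s h, value₄]
    simp only [Finset.mem_insert, Finset.mem_singleton] at hr hs
    split_ifs <;> first | assumption | (exfalso; omega)

/-- Take J to be the last four strands and compose f_J with the exchange automorphism. By
classification the result is f_I up to an automorphism of F_2, and I is found from which generators
are killed. -/
theorem exists_card_three_equivalent_card_four (hn : 4 ≤ n) : ∃ I J : Finset (Fin n),
    I.card = 3 ∧ J.card = 4 ∧ Equivalent (standardHom I) (standardHom J) := by
  obtain ⟨k, rfl⟩ := Nat.exists_eq_add_of_le' hn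
  obtain ⟨φ, m, h1, h2⟩ := exists_mulEquiv_exchange (k + 2)
  let p0 : Fin (k + 4) := ⟨k, by omega⟩
  let p1 : Fin (k + 4) := ⟨k + 1, by omega⟩
  let p2 : Fin (k + 4) := ⟨k + 2, by omega⟩
  let p3 : Fin (k + 4) := ⟨k + 3, by omega⟩
  let J : Finset (Fin (k + 4)) := {p0, p1, p2, p3}
  have l01 : p0 < p1 := by simp [p0, p1]
  have l12 : p1 < p2 := by simp [p1, p2]
  have l23 : p2 < p3 := by simp [p2, p3]
  have hJ : J.card = 4 := by
    simp [J, p0, p1, p2, p3]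
  have hval := fun {r s} (h : r < s) => standardHom_value₄ l01 l12 l23 (r := r) (s := s) h
  have hsurj : Function.Surjective (standardHom J) :=
    (isStandard_standardHom (Or.inr hJ)).surjective
  -- The image is central in F_2, hence trivial; the undetermined exponent of the full twist is
  -- therefore harmless.
  have hZ : standardHom J (fullTwist (k + 4) (k + 3)) = 1 := by
    apply eq_one_of_forall_commute
    intro v
    obtain ⟨a, rfl⟩ := hsurj v
    exact (fullTwist_commute (by omega) a).map (standardHom J)
  have hlow : ∀ d ≤ k, standardHom J (strandProd (k + 4) (k + 2) d) = 1 := by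
    intro d
    induction d with
    | zero => intro _; exact map_one _
    | succ d ih =>
      intro hd
      rw [strandProd, map_mul, ih (by omega), one_mul]
      apply standardHom_pureBd_eq_one
      intro hr hs h
      simp [J, p0, p1, p2, p3] at h
      omega
  -- The surviving factors multiply to y · y⁻¹x⁻¹ · x = 1, so strand p3 is no longer linked with p2.
  have hlast : standardHom J (φ (A p2 p3 l23)) = 1 := by
    rw [A_eq_pureBd, h2, map_mul, map_zpow, hZ, one_zpow, mul_one, map_inv, inv_eq_one, map_mul,
      strandProd, strandProd, map_mul, map_mul, hlow k le_rfl, one_mul]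
    have e1 := hval (l01.trans l12)
    have e2 := hval l12
    have e3 := hval l23
    rw [A_eq_pureBd] at e1 e2 e3
    rw [e1, e2, e3]
    simp [value₄, p0, p1, p2, p3]
  have hfix : ∀ {r s : Fin (k + 4)} (h : r < s), s < p3 → φ (A r s h) = A r s h := by
    intro r s h hs
    rw [A_eq_pureBd h]
    exact h1 r s h hs
  have hsurj' : Function.Surjective ((standardHom J).comp φ.toMonoidHom) :=
    hsurj.comp φ.surjective
  obtain ⟨I, g, hI, hg⟩ := exists_eq_comp_standardHom (by omega)
    ((standardHom J).comp φ.toMonoidHom) (by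
      obtain ⟨a, ha⟩ := hsurj' x
      obtain ⟨b, hb⟩ := hsurj' y
      refine ⟨a, b, fun h => ?_⟩
      rw [ha, hb] at h
      exact FreeGroup.of_ne_one 1 (eq_one_of_commute_of_commute (show (0 : Fin 2) ≠ 1 by decide)
        h.symm (Commute.refl _)))
  have hg' : ∀ a, standardHom J (φ a) = g (standardHom I a) := fun a => DFunLike.congr_fun hg a
  have hgsurj : Function.Surjective g := fun v => by
    obtain ⟨a, ha⟩ := hsurj' v
    exact ⟨standardHom I a, (hg' a).symm.trans ha⟩
  have hginj := injective_of_surjective_freeGroup g hgsurj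
  have hmem : ∀ {r s : Fin (k + 4)} (h : r < s), standardHom J (φ (A r s h)) ≠ 1 →
      r ∈ I ∧ s ∈ I := by
    intro r s h hne
    by_contra hc
    rw [hg', standardHom_A_eq_one h hc, map_one] at hne
    exact hne rfl
  have hnmem : ∀ {r s : Fin (k + 4)} (h : r < s), standardHom J (φ (A r s h)) = 1 →
      ¬(r ∈ I ∧ s ∈ I) := by
    intro r s h he hc
    rw [hg', map_eq_one_iff g hginj] at he
    exact standardHom_A_ne_one hI h hc.1 hc.2 he
  have hp2 : p2 ∈ I := (hmem l12 (by
    rw [hfix _ l23]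
    exact standardHom_A_ne_one (Or.inr hJ) _ (by simp [J]) (by simp [J]))).2
  have hp3 : p3 ∉ I := fun h => hnmem l23 hlast ⟨hp2, h⟩
  have hsub : I ⊆ {p0, p1, p2} := by
    intro r hr
    rcases lt_trichotomy r p2 with h | rfl | h
    · by_contra hc
      refine hnmem h ?_ ⟨hr, hp2⟩
      rw [hfix h l23]
      apply standardHom_A_eq_one
      intro hrJ
      have : r ∈ J := hrJ.1
      simp only [J, Finset.mem_insert, Finset.mem_singleton] at this hc
      have : r ≠ p3 := (h.trans l23).ne
      tauto
    · simp
    · obtain rfl : r = p3 := by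
        have h' : k + 2 < (r : ℕ) := h
        exact Fin.ext (show (r : ℕ) = k + 3 by omega)
      exact absurd hr hp3
  refine ⟨I, J, ?_, hJ, φ, MulEquiv.ofBijective g ⟨hginj, hgsurj⟩, hg'⟩
  have := (Finset.card_le_card hsub).trans Finset.card_le_three
  omega

end Exchange

/-! ### Equivalence of the standard homomorphisms and the final factorization -/

section Equivalence

open scoped Pointwise

variable {n : ℕ}

theorem Equivalent.symm {G H : Type*} [Group G] [Group H] {f g : G →* H} (h : Equivalent f g) :
    Equivalent g f := by
  obtain ⟨φ, ψ, h⟩ := h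
  refine ⟨φ.symm, ψ.symm, fun a => ?_⟩
  rw [MulEquiv.eq_symm_apply, ← h, MulEquiv.apply_symm_apply]

theorem Equivalent.trans {G H : Type*} [Group G] [Group H] {f g k : G →* H}
    (h₁ : Equivalent f g) (h₂ : Equivalent g k) : Equivalent f k := by
  obtain ⟨φ, ψ, h₁⟩ := h₁
  obtain ⟨φ', ψ', h₂⟩ := h₂
  exact ⟨φ.trans φ', ψ.trans ψ', fun a => by
    rw [MulEquiv.trans_apply, MulEquiv.trans_apply, h₂, h₁]⟩

theorem toPerm_surjective : Function.Surjective (toPerm n) := by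
  rcases n with _ | n
  · exact fun π => ⟨1, Subsingleton.elim _ _⟩
  rw [← MonoidHom.mrange_eq_top, eq_top_iff, ← Equiv.Perm.mclosure_swap_castSucc_succ,
    Submonoid.closure_le]
  rintro _ ⟨i, rfl⟩
  exact ⟨sigma (n := n + 1) i, toPerm_sigma (n := n + 1) i⟩

theorem exists_smul_eq_of_card_eq {I J : Finset (Fin n)} (h : I.card = J.card) :
    ∃ π : Equiv.Perm (Fin n), π • I = J := by
  refine ⟨(Finset.equivOfCardEq h).extendSubtype, ?_⟩
  refine Finset.eq_of_subset_of_card_le ?_ (by rw [Finset.card_smul_finset, h])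
  intro a ha
  obtain ⟨b, hb, rfl⟩ := Finset.mem_smul_finset.1 ha
  exact (Finset.equivOfCardEq h).extendSubtype_mem b hb

/-- Some permutation carries I to J; conjugation by a braid lifting it is the required automorphism
of P_n. -/
theorem equivalent_of_card_eq {I J : Finset (Fin n)} (h : I.card = J.card) :
    Equivalent (standardHom I) (standardHom J) := by
  obtain ⟨π, rfl⟩ := exists_smul_eq_of_card_eq h
  obtain ⟨β, rfl⟩ := toPerm_surjective π
  obtain ⟨ψ, hψ⟩ := standardHom_conj (toPerm n β • I) β
  rw [inv_smul_smul] at hψ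
  exact ⟨MulAut.conjNormal β, ψ, hψ⟩

theorem equivalent_standardHom {I J : Finset (Fin n)} (hI : I.card = 3 ∨ I.card = 4)
    (hJ : J.card = 3 ∨ J.card = 4) : Equivalent (standardHom I) (standardHom J) := by
  have key : ∀ {I J : Finset (Fin n)}, I.card = 3 → J.card = 4 →
      Equivalent (standardHom I) (standardHom J) := by
    intro I J hI hJ
    have hn : 4 ≤ n := by simpa [hJ] using Finset.card_le_univ J
    obtain ⟨I', J', hI', hJ', h⟩ := exists_card_three_equivalent_card_four hn
    exact ((equivalent_of_card_eq (hI.trans hI'.symm)).trans h).trans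
      (equivalent_of_card_eq (hJ'.trans hJ.symm))
  rcases hI with hI | hI <;> rcases hJ with hJ | hJ
  · exact equivalent_of_card_eq (hI.trans hJ.symm)
  · exact key hI hJ
  · exact (key hJ hI).symm
  · exact equivalent_of_card_eq (hI.trans hJ.symm)

/-- An epimorphism from the pure braid group to a noncyclic free group factors through a standard
one. -/
theorem exists_surjective_eq_comp_standardHom (hn : 3 ≤ n) {k : ℕ} (hk : 2 ≤ k)
    {f : PureBraidGroup n →* F k} (hf : Function.Surjective f) :
    ∃ (I : Finset (Fin n)) (g : F 2 →* F k), (I.card = 3 ∨ I.card = 4) ∧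
      Function.Surjective g ∧ f = g.comp (standardHom I) := by
  have h01 : (⟨0, by omega⟩ : Fin k) ≠ ⟨1, by omega⟩ := by simp
  obtain ⟨a, ha⟩ := hf (FreeGroup.of ⟨0, by omega⟩)
  obtain ⟨b, hb⟩ := hf (FreeGroup.of ⟨1, by omega⟩)
  obtain ⟨I, g, hI, rfl⟩ := exists_eq_comp_standardHom hn f ⟨a, b, fun h => by
    rw [ha, hb] at h
    exact FreeGroup.of_ne_one _ (eq_one_of_commute_of_commute h01 h.symm (Commute.refl _))⟩
  exact ⟨I, g, hI, Function.Surjective.of_comp hf, rfl⟩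

theorem exists_mulEquiv_eq_comp_standardHom (hn : 3 ≤ n) {f : PureBraidGroup n →* F 2}
    (hf : Function.Surjective f) : ∃ (I : Finset (Fin n)) (ψ : F 2 ≃* F 2),
      (I.card = 3 ∨ I.card = 4) ∧ f = ψ.toMonoidHom.comp (standardHom I) := by
  obtain ⟨I, g, hI, hg, rfl⟩ := exists_surjective_eq_comp_standardHom hn le_rfl hf
  exact ⟨I, MulEquiv.ofBijective g ⟨injective_of_surjective_freeGroup g hg, hg⟩, hI, rfl⟩

end Equivalence
end PureBraid

theorem mainTheorem2 (n : ℕ) (hn : 3 ≤ n) :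
    (∀ k : ℕ, 3 ≤ k →
      ¬ ∃ f : PureBraid.PureBraidGroup n →* PureBraid.F k, Function.Surjective f) ∧
    ((∃ f : PureBraid.PureBraidGroup n →* PureBraid.F 2, Function.Surjective f) ∧
      ∀ f g : PureBraid.PureBraidGroup n →* PureBraid.F 2,
        Function.Surjective f → Function.Surjective g → PureBraid.Equivalent f g) ∧
    ((∀ I : Finset (Fin n), (I.card = 3 ∨ I.card = 4) →
        ∃ fI : PureBraid.PureBraidGroup n →* PureBraid.F 2,
          PureBraid.IsStandard I fI ∧ Function.Surjective fI ∧
          ∀ g : PureBraid.PureBraidGroup n →* PureBraid.F 2,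
            PureBraid.IsStandard I g → g = fI) ∧
      ∀ f : PureBraid.PureBraidGroup n →* PureBraid.F 2, Function.Surjective f →
        ∃ (I : Finset (Fin n)) (fI : PureBraid.PureBraidGroup n →* PureBraid.F 2)
          (ψ : PureBraid.F 2 ≃* PureBraid.F 2),
          (I.card = 3 ∨ I.card = 4) ∧ PureBraid.IsStandard I fI ∧
            f = ψ.toMonoidHom.comp fI) := by
  refine ⟨?_, ⟨?_, ?_⟩, ?_, ?_⟩
  · rintro k hk ⟨f, hf⟩
    obtain ⟨I, g, -, hg, -⟩ :=
      PureBraid.exists_surjective_eq_comp_standardHom hn (by omega) hf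
    have := PureBraid.card_le_of_surjective_freeGroup g hg
    simp only [Fintype.card_fin] at this
    omega
  · obtain ⟨I, -, hI⟩ := Finset.exists_subset_card_eq
      (show 3 ≤ (Finset.univ : Finset (Fin n)).card by simpa using hn)
    exact ⟨PureBraid.standardHom I,
      (PureBraid.isStandard_standardHom (Or.inl hI)).surjective⟩
  · intro f g hf hg
    obtain ⟨I, ψ, hI, rfl⟩ := PureBraid.exists_mulEquiv_eq_comp_standardHom hn hf
    obtain ⟨J, ψ', hJ, rfl⟩ := PureBraid.exists_mulEquiv_eq_comp_standardHom hn hg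
    obtain ⟨φ, θ, h⟩ := PureBraid.equivalent_standardHom hI hJ
    exact ⟨φ, ψ.symm.trans (θ.trans ψ'), fun a => by simp [h]⟩
  · intro I hI
    have h := PureBraid.isStandard_standardHom hI
    exact ⟨_, h, h.surjective, fun g hg => hg.eq_standardHom⟩
  · intro f hf
    obtain ⟨I, ψ, hI, rfl⟩ := PureBraid.exists_mulEquiv_eq_comp_standardHom hn hf
    exact ⟨I, _, ψ, hI, PureBraid.isStandard_standardHom hI, rfl⟩
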